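/- Let $n\ge 1$ and let $C=\mathbb{R}^n_{\ge 0}$ be the positive orthant. A polyhedron is a finite intersection of closed half-spaces; it is a lattice polyhedron if all its vertices lie in $\mathbb{Z}^n$. Consider tuples $(B_1,\dots,B_n)$ of lattice polyhedra in $\mathbb{R}^n$ such that every $B_i$ has the same support cone as $C$ (the same linear functionals are bounded below on $B_i$ and on $C$) and bounded symmetric difference with $C$. For a pair $(A,B)$ of polyhedra with this support cone and with bounded symmetric difference put $\mathrm{V}(A,B)=n!\,\bigl(\mathrm{vol}(A\setminus B)-\mathrm{vol}(B\setminus A)\bigr)$, where $\mathrm{vol}$ is Lebesgue measure. The relative mixed volume of $(B_1,\dots,B_n)$ is $\mathrm{Vol}_C((C,B_1),\dots,(C,B_n))$, where $\mathrm{Vol}_C$ is the symmetric multilinear function (with respect to componentwise Minkowski addition of pairs) whose value at $n$ equal pairs $(A,B)$ is $\mathrm{V}(A,B)$; explicitly, $$\mathrm{Vol}_C((A_1,B_1),\dots,(A_n,B_n))=\frac1{n!}\sum_{\emptyset\ne I\subseteq\{1,\dots,n\}}(-1)^{n-|I|}\,\mathrm{V}\Bigl(\sum_{i\in I}A_i,\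 \sum_{i\in I}B_i\Bigr).$$ The tuple $(B_1,\dots,B_n)$ is called minimal with mixed volume $V$ if its relative mixed volume equals $V$ and, for every $i$ and every lattice point $\delta\in (C\setminus B_i)\cap\mathbb{Z}^n$, replacing $B_i$ by $\mathrm{conv}(B_i\cup\{\delta\})$ gives a tuple of relative mixed volume strictly less than $V$. Theorem. For every $n$ and every $V$, there are only finitely many tuples $(B_1,\dots,B_n)$ of this kind that are minimal with mixed volume $V$. Moreover, every such tuple of lattice polyhedra of relative mixed volume $V$ is contained, component by component, in a minimal tuple with mixed volume $V$ (Esterov's conjecture). -/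

import Mathlib

open MeasureTheory
open scoped Pointwise Nat

namespace RelMixedVolume

noncomputable section

/-- A polyhedron in `ℝⁿ`: an intersection of finitely many closed half-spaces `{x | c ≤ γ x}`,
`γ ≠ 0`. -/
def IsPolyhedron {n : ℕ} (P : Set (Fin n → ℝ)) : Prop :=
  ∃ s : Set (Module.Dual ℝ (Fin n → ℝ) × ℝ), s.Finite ∧ (∀ h ∈ s, h.1 ≠ 0) ∧
    P = {x | ∀ h ∈ s, h.2 ≤ h.1 x}

/-- The lattice `ℤⁿ` inside `ℝⁿ`. -/
def latticePoints (n : ℕ) : Set (Fin n → ℝ) :=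
  {x | ∀ j, ∃ m : ℤ, x j = m}

/-- A lattice polyhedron: all vertices (extreme points) lie in `ℤⁿ`. -/
def IsLatticePolyhedron {n : ℕ} (P : Set (Fin n → ℝ)) : Prop :=
  IsPolyhedron P ∧ P.extremePoints ℝ ⊆ latticePoints n

/-- The support cone of `K`: the covectors `γ` with `inf_{x ∈ K} γ x > -∞`. -/
def supportCone {n : ℕ} (K : Set (Fin n → ℝ)) : Set (Module.Dual ℝ (Fin n → ℝ)) :=
  {γ | BddBelow (γ '' K)}

/-- The set `M_Γ` of pairs of polyhedra with support cone `Γ` and bounded symmetric difference. -/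
def polyhedronPairs {n : ℕ} (Γ : Set (Module.Dual ℝ (Fin n → ℝ))) :
    Set (Set (Fin n → ℝ) × Set (Fin n → ℝ)) :=
  {p | IsPolyhedron p.1 ∧ IsPolyhedron p.2 ∧ supportCone p.1 = Γ ∧ supportCone p.2 = Γ ∧
    Bornology.IsBounded (symmDiff p.1 p.2)}

/-- The (lattice) volume of a pair `(A, B)`: the difference of the lattice volumes of `A \ B` and
`B \ A`, where the lattice volume is `n!` times Lebesgue measure. -/
def pairVolume {n : ℕ} (p : Set (Fin n → ℝ) × Set (Fin n → ℝ)) : ℝ :=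
  (n ! : ℝ) * (volume.real (p.1 \ p.2) - volume.real (p.2 \ p.1))

/-- The mixed volume of `n` pairs of polyhedra in `ℝⁿ`, i.e. the polarization of `pairVolume` with
respect to componentwise Minkowski addition of pairs. The factor `1 / n!` normalizes it so that the
mixed volume of `n` equal pairs is the volume of that pair. The sums over `i ∈ I` are Minkowski
sums; the empty one is `({0}, {0})` and contributes `0`. -/
def mixedVolume {n : ℕ} (p : Fin n → Set (Fin n → ℝ) × Set (Fin n → ℝ)) : ℝ :=
  (1 / (n ! : ℝ)) * ∑ I : Finset (Fin n), (-1 : ℝ) ^ (n - I.card) * pairVolume (∑ i ∈ I, p i)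

/-- The positive orthant `C` in `ℝⁿ`. -/
def orthant (n : ℕ) : Set (Fin n → ℝ) := {x | ∀ j, 0 ≤ x j}

/-- The relative mixed volume of the pairs `(C, B 1), …, (C, B n)`. -/
def relMixedVolume {n : ℕ} (B : Fin n → Set (Fin n → ℝ)) : ℝ :=
  mixedVolume fun i => (orthant n, B i)

/-- A tuple of `n` lattice polyhedra in `ℝⁿ`, each forming with the positive orthant `C` a pair of
polyhedra with the same support cone as `C` and with bounded symmetric difference. -/
def IsLatticeTuple {n : ℕ} (B : Fin n → Set (Fin n → ℝ)) : Prop :=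
  ∀ i, IsLatticePolyhedron (B i) ∧
    (orthant n, B i) ∈ polyhedronPairs (supportCone (orthant n))

/-- A tuple of lattice polyhedra is minimal with mixed volume `V` if its relative mixed volume is
`V` and adjoining any further lattice point of `C` to any one of the polyhedra makes the relative
mixed volume smaller than `V`. -/
def IsMinimalTuple {n : ℕ} (V : ℝ) (B : Fin n → Set (Fin n → ℝ)) : Prop :=
  IsLatticeTuple B ∧ relMixedVolume B = V ∧
    ∀ i, ∀ δ ∈ orthant n \ B i, δ ∈ latticePoints n →
      relMixedVolume (Function.update B i (convexHull ℝ (B i ∪ {δ}))) < V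

end

end RelMixedVolume

/-!
The proof combines two facts.

*Monotonicity.* Enlarging the polyhedra `B i` inside the orthant can only decrease the relative
mixed volume (`relMixedVolume_anti`). Intersecting all `B i` with a large simplex reduces this to
monotonicity of the mixed volume of lattice polytopes (`relMixedVolume_eq`,
`alternating_volume_convexHull_mono`). For exponential sums with full-dimensional Newton polytopes
`P i` and a nonempty set of indices `I`, the gradient of the sum over `i ∈ I` of their logarithms
maps `ℝⁿ` bijectively onto a set between the interior of `∑ i ∈ I, P i` and the sum itself. By the
change of variables formula, the volume of this sum is the integral of the determinant of the sum of
the Hessians (`volume_sum_newton`), so the mixed volume is the integral of the mixed discriminant of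
the Hessians, which is nonnegative as these are positive semidefinite (`mixedDiscriminant_nonneg`).
If the Newton polytopes grow by exponents of weight `t`, then for every `t > 0` the integral is the
mixed volume of the larger polytopes, while the integrand tends to that of the smaller ones as `t →
0`. Fatou's lemma gives the inequality.

*Well-quasi-order.* The lattice points of a polyhedron as in the theorem form an upper set of `ℕⁿ`
that determines the polyhedron, and upper sets of `ℕⁿ` are well-quasi-ordered by reverse inclusion
(`wellQuasiOrderedLE_upperSet_fin`), by induction on `n` with Higman's lemma.

By monotonicity a minimal tuple is not properly contained in another tuple of the same relative
mixed volume (`IsMinimalTuple.eq_of_subset`), so minimal tuples of relative mixed volume `V` form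
an antichain, which is finite. A tuple that is not minimal admits a further lattice point that
leaves its relative mixed volume unchanged, and `C \ B i` has only finitely many lattice points, so
that repeating this ends in a minimal tuple (`exists_isMinimalTuple`). Here it is used that
`conv (B i ∪ {δ})` is again a lattice polyhedron of the same kind
(`Admissible.convexHull_union_singleton`).

All this takes place in dimension at least two, where the `B i` lie in the orthant. In dimension
one every `B i` is a half-line `[b, ∞)`, possibly with `b < 0`, and its relative mixed volume is
`b`; in dimension zero there is only the empty tuple.
-/

/-! ### Upper sets of ℕⁿ are well-quasi-ordered -/

namespace RelMixedVolume

/-- If `l₁` is dominated by a sublist of a decreasing list `l₂`, then it is dominated entry by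
entry by `l₂`: passing to a sublist can only move an entry to an earlier position. -/
theorem getElem_le_of_sublistForall₂ {α : Type*} [Preorder α] {l₁ l₂ : List α}
    (h : List.SublistForall₂ (· ≤ ·) l₁ l₂)
    (hl : ∀ i j : ℕ, ∀ hj : j < l₂.length, ∀ hij : i ≤ j, l₂[j] ≤ l₂[i])
    (k : ℕ) (hk : k < l₁.length) : ∃ hk' : k < l₂.length, l₁[k] ≤ l₂[k] := by
  obtain ⟨l, h1, h2⟩ := List.sublistForall₂_iff.1 h
  obtain ⟨f, hf⟩ := List.sublist_iff_exists_orderEmbedding_getElem?_eq.1 h2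
  have hlen := h1.length_eq
  have hfk : k ≤ f k := f.strictMono.le_apply
  have e := hf k
  rw [List.getElem?_eq_getElem (hlen ▸ hk)] at e
  obtain ⟨hlt, e'⟩ := List.getElem?_eq_some_iff.1 e.symm
  refine ⟨hfk.trans_lt hlt, ?_⟩
  have h3 : l₁[k] ≤ l[k]'(hlen ▸ hk) := List.Forall₂.get h1 hk (hlen ▸ hk)
  exact h3.trans (e' ▸ hl k (f k) hlt hfk)

/-- The slice `{a | (k, a) ∈ U}` of an upper set in `ℕ × α`. -/
def slice {α : Type*} [Preorder α] (U : UpperSet (ℕ × α)) (k : ℕ) : UpperSet α :=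
  ⟨{a | (k, a) ∈ U}, fun _ _ hab ha => U.upper (Prod.mk_le_mk.2 ⟨le_rfl, hab⟩) ha⟩

theorem slice_antitone {α : Type*} [Preorder α] (U : UpperSet (ℕ × α)) : Antitone (slice U) :=
  fun _ _ hkl _ ha => U.upper (Prod.mk_le_mk.2 ⟨hkl, le_rfl⟩) ha

/-- An upper set in `ℕ × α` is an increasing sequence of upper sets in `α`, which becomes
stationary; Higman's lemma compares the finite words of slices before stabilization. -/
theorem wellQuasiOrderedLE_upperSet_nat_prod {α : Type*} [Preorder α]
    [hα : WellQuasiOrderedLE (UpperSet α)] : WellQuasiOrderedLE (UpperSet (ℕ × α)) := by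
  refine ⟨fun U => ?_⟩
  have hst : ∀ i, ∃ m, ∀ k, m ≤ k → slice (U i) m = slice (U i) k := by
    intro i
    exact WellFoundedLT.antitone_chain_condition (slice_antitone (U i))
  choose m hm using hst
  obtain ⟨g, hg⟩ := (wellQuasiOrdered_le (α := UpperSet α)).exists_monotone_subseq
    (fun i => slice (U i) (m i))
  have hpwo : (Set.univ : Set (UpperSet α)).PartiallyWellOrderedOn (· ≤ ·) :=
    Set.isPWO_univ_iff.2 hα
  have hig := hpwo.partiallyWellOrderedOn_sublistForall₂ (· ≤ ·)
  obtain ⟨p, q, hpq, h⟩ := hig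
    (fun i => ⟨(List.range (m (g i))).map (slice (U (g i))), by simp⟩)
  refine ⟨g p, g q, g.strictMono hpq, ?_⟩
  rintro ⟨k, a⟩ ha
  suffices slice (U (g p)) k ≤ slice (U (g q)) k from this ha
  by_cases hk : k < m (g p)
  · obtain ⟨hk', hle⟩ := getElem_le_of_sublistForall₂ h (by
      intro i j hj hij
      simpa using slice_antitone (U (g q)) hij) k (by simpa using hk)
    simpa using hle
  · rw [← hm (g p) k (not_lt.1 hk)]
    refine (hg p q hpq.le).trans ?_
    rcases le_total (m (g q)) k with h1 | h1
    · exact (hm (g q) k h1).le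
    · exact slice_antitone _ h1

/-- **Maclagan's theorem** in order-theoretic form: the upper sets of `ℕⁿ`, i.e. the monomial
ideals in `n` variables, are well-quasi-ordered by reverse inclusion. -/
theorem wellQuasiOrderedLE_upperSet_fin (n : ℕ) : WellQuasiOrderedLE (UpperSet (Fin n → ℕ)) := by
  induction n with
  | zero =>
    have : Finite (UpperSet (Fin 0 → ℕ)) :=
      Finite.of_injective (fun U => (U : Set (Fin 0 → ℕ))) SetLike.coe_injective
    exact Finite.to_wellQuasiOrderedLE
  | succ n ih =>
    have := wellQuasiOrderedLE_upperSet_nat_prod (α := Fin n → ℕ)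
    let e : (ℕ × (Fin n → ℕ)) ≃o (Fin (n + 1) → ℕ) := Fin.consOrderIso (fun _ => ℕ)
    exact (UpperSet.map e).wellQuasiOrderedLE_iff.1 this

end RelMixedVolume

/-! ### Mixed discriminants -/

namespace RelMixedVolume

/-- The case of **Cauchy–Binet** for a weighted sum of squares of vectors. -/
theorem factorial_mul_det_sum_vecMulVec {n : ℕ} {σ : Type*} [Fintype σ] (c : σ → ℝ)
    (u : σ → Fin n → ℝ) :
    (n ! : ℝ) * (∑ s, c s • Matrix.vecMulVec (u s) (u s)).det =
      ∑ f : Fin n → σ, (∏ i, c (f i)) * (Matrix.of fun i => u (f i)).det ^ 2 := by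
  classical
  have h1 : (∑ s, c s • Matrix.vecMulVec (u s) (u s)).det =
      ∑ f : Fin n → σ, (∏ i, c (f i)) * ((∏ i, u (f i) i) *
        (Matrix.of fun i => u (f i)).det) := by
    have e : (∑ s, c s • Matrix.vecMulVec (u s) (u s)) =
        (fun i => ∑ s, (c s * u s i) • u s : Fin n → Fin n → ℝ) := by
      ext i j
      simp [Matrix.sum_apply, Matrix.vecMulVec_apply, mul_assoc]
    rw [e]
    have := (Matrix.detRowAlternating (n := Fin n) (R := ℝ)).toMultilinearMap.map_sum
      (fun (i : Fin n) (s : σ) => (c s * u s i) • u s)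
    refine this.trans (Finset.sum_congr rfl fun f _ => ?_)
    rw [MultilinearMap.map_smul_univ, Finset.prod_mul_distrib, smul_eq_mul, mul_assoc]
    rfl
  have h2 : ∀ τ : Equiv.Perm (Fin n), (∑ s, c s • Matrix.vecMulVec (u s) (u s)).det =
      ∑ f : Fin n → σ, (∏ i, c (f i)) * ((Equiv.Perm.sign τ • ∏ i, u (f (τ i)) i) *
        (Matrix.of fun i => u (f i)).det) := by
    intro τ
    rw [h1, ← (Equiv.arrowCongr τ.symm (Equiv.refl σ)).sum_comp]
    refine Finset.sum_congr rfl fun f _ => ?_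
    have e1 : ∏ i, c (f (τ i)) = ∏ i, c (f i) := Equiv.prod_comp τ (fun i => c (f i))
    have e2 : (Matrix.of fun i => u (f (τ i))).det =
        Equiv.Perm.sign τ * (Matrix.of fun i => u (f i)).det :=
      Matrix.det_permute τ (Matrix.of fun i => u (f i))
    simp only [Equiv.arrowCongr_apply, Equiv.symm_symm, Equiv.coe_refl, Function.comp_apply, id_eq]
    rw [e1, e2, Units.smul_def, zsmul_eq_mul]
    ring
  have h3 : ∑ τ : Equiv.Perm (Fin n), (∑ s, c s • Matrix.vecMulVec (u s) (u s)).det =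
      (n ! : ℝ) * (∑ s, c s • Matrix.vecMulVec (u s) (u s)).det := by
    simp [Fintype.card_perm]
  rw [← h3, Finset.sum_congr rfl fun τ _ => h2 τ, Finset.sum_comm]
  refine Finset.sum_congr rfl fun f _ => ?_
  rw [← Finset.mul_sum, ← Finset.sum_mul, sq]
  congr 2
  rw [Matrix.det_apply]
  rfl

theorem sum_neg_one_pow_ite_subset {n : ℕ} (J : Finset (Fin n)) :
    ∑ I : Finset (Fin n), (-1 : ℝ) ^ (n - I.card) * (if J ⊆ I then 1 else 0) =
      if J = Finset.univ then 1 else 0 := by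
  have h1 : ∑ I : Finset (Fin n), (-1 : ℝ) ^ (n - I.card) * (if J ⊆ I then 1 else 0) =
      ∑ K : Finset (Fin n), (if K ⊆ Jᶜ then (-1 : ℝ) ^ K.card else 0) := by
    refine Finset.sum_bij' (fun I _ => Iᶜ) (fun K _ => Kᶜ) (by simp) (by simp) (by simp) (by simp)
      fun I _ => ?_
    have hiff : Iᶜ ⊆ Jᶜ ↔ J ⊆ I := Finset.compl_subset_compl
    rw [Finset.card_compl, Fintype.card_fin]
    by_cases h : J ⊆ I
    · rw [if_pos h, if_pos (hiff.2 h), mul_one]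
    · rw [if_neg h, if_neg (mt hiff.1 h), mul_zero]
  rw [h1, ← Finset.sum_filter]
  have h2 : (Finset.univ.filter fun K : Finset (Fin n) => K ⊆ Jᶜ) = Jᶜ.powerset := by
    ext; simp
  rw [h2]
  have h3 := Finset.sum_powerset_neg_one_pow_card (x := Jᶜ)
  have h4 : (∑ K ∈ Jᶜ.powerset, (-1 : ℝ) ^ K.card) =
      ((∑ K ∈ Jᶜ.powerset, (-1 : ℤ) ^ K.card : ℤ) : ℝ) := by push_cast; rfl
  rw [h4, h3]
  simp [Finset.compl_eq_empty_iff]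

/-- The mixed discriminant, scaled by `n!`: the polarization of the determinant. -/
noncomputable def mixedDiscriminant {n : ℕ} (H : Fin n → Matrix (Fin n) (Fin n) ℝ) : ℝ :=
  ∑ I : Finset (Fin n), (-1 : ℝ) ^ (n - I.card) * (∑ i ∈ I, H i).det

/-- The mixed discriminant of positive semidefinite matrices is nonnegative: after expanding all
determinants by Cauchy–Binet, inclusion–exclusion leaves only the terms that take one rank one
summand from each matrix. -/
theorem mixedDiscriminant_nonneg {n : ℕ} {σ : Type*} [Fintype σ] (c : Fin n → σ → ℝ)
    (hc : ∀ i s, 0 ≤ c i s) (u : σ → Fin n → ℝ) :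
    0 ≤ mixedDiscriminant fun i => ∑ s, c i s • Matrix.vecMulVec (u s) (u s) := by
  classical
  have key : (n ! : ℝ) * mixedDiscriminant (fun i => ∑ s, c i s • Matrix.vecMulVec (u s) (u s)) =
      ∑ f : Fin n → Fin n × σ, (if Finset.univ.image (fun k => (f k).1) = Finset.univ then 1 else 0)
        * ((∏ k, c (f k).1 (f k).2) * (Matrix.of fun k => u (f k).2).det ^ 2) := by
    have h1 : ∀ I : Finset (Fin n), (n ! : ℝ) *
        (∑ i ∈ I, ∑ s, c i s • Matrix.vecMulVec (u s) (u s)).det =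
        ∑ f : Fin n → Fin n × σ, (if Finset.univ.image (fun k => (f k).1) ⊆ I then 1 else 0)
        * ((∏ k, c (f k).1 (f k).2) * (Matrix.of fun k => u (f k).2).det ^ 2) := by
      intro I
      have e : (∑ i ∈ I, ∑ s, c i s • Matrix.vecMulVec (u s) (u s)) =
          ∑ q : Fin n × σ, ((if q.1 ∈ I then 1 else 0) * c q.1 q.2) •
            Matrix.vecMulVec (u q.2) (u q.2) := by
        rw [Fintype.sum_prod_type, ← Finset.sum_filter_add_sum_filter_not Finset.univ (· ∈ I)]
        simp only [Finset.filter_mem_eq_inter, Finset.univ_inter]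
        rw [Finset.sum_eq_zero (s := Finset.univ.filter fun x => x ∉ I), add_zero]
        · exact Finset.sum_congr rfl fun i hi => by simp [hi]
        · intro i hi
          simp [(Finset.mem_filter.1 hi).2]
      rw [e, factorial_mul_det_sum_vecMulVec
        (fun q : Fin n × σ => (if q.1 ∈ I then 1 else 0) * c q.1 q.2) (fun q => u q.2)]
      refine Finset.sum_congr rfl fun f _ => ?_
      rw [Finset.prod_mul_distrib, mul_assoc]
      congr 1
      rw [Finset.prod_ite_zero]
      simp [Finset.image_subset_iff]
    unfold mixedDiscriminant
    rw [Finset.mul_sum]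
    simp_rw [mul_left_comm (n ! : ℝ), h1, Finset.mul_sum]
    rw [Finset.sum_comm]
    refine Finset.sum_congr rfl fun f _ => ?_
    simp_rw [← mul_assoc]
    rw [← Finset.sum_mul, ← Finset.sum_mul, sum_neg_one_pow_ite_subset]
  have hpos : (0 : ℝ) < n ! := by positivity
  refine nonneg_of_mul_nonneg_right (a := (n ! : ℝ)) ?_ hpos
  rw [key]
  refine Finset.sum_nonneg fun f _ => mul_nonneg (by split_ifs <;> norm_num)
    (mul_nonneg (Finset.prod_nonneg fun k _ => hc _ _) (sq_nonneg _))

end RelMixedVolume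

/-! ### Log-partition functions and their derivatives -/

namespace RelMixedVolume

open Filter Topology

noncomputable section

/-- The linear functional `x ↦ v ⬝ᵥ x` as a continuous linear map. -/
def dotCLM {n : ℕ} (v : Fin n → ℝ) : (Fin n → ℝ) →L[ℝ] ℝ :=
  ∑ j, v j • ContinuousLinearMap.proj j

@[simp]
theorem dotCLM_apply {n : ℕ} (v x : Fin n → ℝ) : dotCLM v x = v ⬝ᵥ x := by
  simp [dotCLM, dotProduct]

section Gibbs

variable {n : ℕ} {ι : Type*} [Fintype ι] (a : ι → Fin n → ℝ) (w : ι → ℝ) (x : Fin n → ℝ)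

/-- The exponential sum `∑ₖ wₖ exp (aₖ ⬝ᵥ x)`. -/
def expSum : ℝ := ∑ k, w k * Real.exp (a k ⬝ᵥ x)

/-- The probability `wₖ exp (aₖ ⬝ᵥ x) / expSum a w x` of the point `aₖ` under the Gibbs
distribution at `x`, written with the normalization in the exponent. -/
def gibbs (k : ι) : ℝ := w k * Real.exp (a k ⬝ᵥ x - Real.log (expSum a w x))

/-- The mean of the Gibbs distribution, which is the gradient of `log (expSum a w)` at `x`. -/
def gibbsMean : Fin n → ℝ := ∑ k, gibbs a w x k • a k

/-- The covariance matrix of the Gibbs distribution, which is the Hessian of `log (expSum a w)`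
at `x`, written as a positive combination of the rank one matrices of differences. -/
def gibbsCov : Matrix (Fin n) (Fin n) ℝ :=
  ∑ q : ι × ι, (gibbs a w x q.1 * gibbs a w x q.2 / 2) •
    Matrix.vecMulVec (a q.1 - a q.2) (a q.1 - a q.2)

variable {a w}

theorem expSum_pos (hw : ∀ k, 0 ≤ w k) (hw' : ∃ k, 0 < w k) : 0 < expSum a w x := by
  obtain ⟨k, hk⟩ := hw'
  exact Finset.sum_pos' (fun k _ => mul_nonneg (hw k) (Real.exp_nonneg _))
    ⟨k, Finset.mem_univ k, mul_pos hk (Real.exp_pos _)⟩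

theorem gibbs_nonneg (hw : ∀ k, 0 ≤ w k) (k : ι) : 0 ≤ gibbs a w x k :=
  mul_nonneg (hw k) (Real.exp_nonneg _)

theorem sum_gibbs (hw : ∀ k, 0 ≤ w k) (hw' : ∃ k, 0 < w k) : ∑ k, gibbs a w x k = 1 := by
  have h := expSum_pos (a := a) x hw hw'
  simp only [gibbs, Real.exp_sub, Real.exp_log h]
  simp_rw [← mul_div_assoc]
  rw [← Finset.sum_div]
  exact div_self h.ne'

theorem hasFDerivAt_log_expSum (hw : ∀ k, 0 ≤ w k) (hw' : ∃ k, 0 < w k) :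
    HasFDerivAt (fun x => Real.log (expSum a w x)) (dotCLM (gibbsMean a w x)) x := by
  have h := expSum_pos (a := a) x hw hw'
  have h1 : HasFDerivAt (expSum a w)
      (∑ k, w k • Real.exp (a k ⬝ᵥ x) • dotCLM (a k)) x := by
    refine HasFDerivAt.fun_sum fun k _ => ?_
    have := ((dotCLM (a k)).hasFDerivAt (x := x)).exp.const_mul (w k)
    simpa using this
  suffices e : dotCLM (gibbsMean a w x) = (expSum a w x)⁻¹ •
      ∑ k, w k • Real.exp (a k ⬝ᵥ x) • dotCLM (a k) from e ▸ h1.log h.ne'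
  ext1 v
  simp only [dotCLM_apply, gibbsMean, sum_dotProduct, smul_dotProduct,
    smul_apply, sum_apply, gibbs, Real.exp_sub,
    Real.exp_log h, smul_eq_mul, Finset.mul_sum]
  refine Finset.sum_congr rfl fun k _ => ?_
  field_simp

theorem hasFDerivAt_gibbs (hw : ∀ k, 0 ≤ w k) (hw' : ∃ k, 0 < w k) (k : ι) :
    HasFDerivAt (fun x => gibbs a w x k)
      (gibbs a w x k • (dotCLM (a k) - dotCLM (gibbsMean a w x))) x := by
  have h := (((dotCLM (a k)).hasFDerivAt (x := x)).sub
    (hasFDerivAt_log_expSum (a := a) x hw hw')).exp.const_mul (w k)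
  rw [smul_smul] at h
  simpa [gibbs] using h

theorem gibbsCov_mulVec (hw : ∀ k, 0 ≤ w k) (hw' : ∃ k, 0 < w k) (h : Fin n → ℝ) :
    (gibbsCov a w x).mulVec h =
      ∑ k, (gibbs a w x k * (a k ⬝ᵥ h - gibbsMean a w x ⬝ᵥ h)) • a k := by
  have h1 := sum_gibbs (a := a) x hw hw'
  set p := gibbs a w x with hp
  have e1 : (gibbsCov a w x).mulVec h =
      ∑ k, ∑ l, ((p k * p l / 2) * (a k ⬝ᵥ h - a l ⬝ᵥ h)) • (a k - a l) := by
    rw [gibbsCov, Matrix.sum_mulVec, Fintype.sum_prod_type]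
    refine Finset.sum_congr rfl fun k _ => Finset.sum_congr rfl fun l _ => ?_
    rw [Matrix.smul_mulVec, Matrix.vecMulVec_mulVec, sub_dotProduct, ← smul_smul,
      op_smul_eq_smul]
  have e2 : ∑ k, ∑ l, ((p k * p l / 2) * (a k ⬝ᵥ h - a l ⬝ᵥ h)) • (a k - a l) =
      ∑ k, ∑ l, ((p k * p l) * (a k ⬝ᵥ h - a l ⬝ᵥ h)) • a k := by
    have e3 : ∑ k, ∑ l, ((p k * p l / 2) * (a k ⬝ᵥ h - a l ⬝ᵥ h)) • a l =
        ∑ k, ∑ l, ((p k * p l / 2) * (a l ⬝ᵥ h - a k ⬝ᵥ h)) • a k := by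
      rw [Finset.sum_comm]
      refine Finset.sum_congr rfl fun k _ => Finset.sum_congr rfl fun l _ => ?_
      rw [mul_comm (p l)]
    simp_rw [smul_sub, Finset.sum_sub_distrib]
    rw [e3, ← Finset.sum_sub_distrib]
    refine Finset.sum_congr rfl fun k _ => ?_
    rw [← Finset.sum_sub_distrib]
    refine Finset.sum_congr rfl fun l _ => ?_
    rw [← sub_smul]
    congr 1
    ring
  rw [e1, e2]
  refine Finset.sum_congr rfl fun k _ => ?_
  rw [← Finset.sum_smul]
  congr 1
  rw [gibbsMean, sum_dotProduct]
  simp_rw [smul_dotProduct, ← hp, mul_assoc, ← Finset.mul_sum, mul_sub, Finset.sum_sub_distrib,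
    ← Finset.sum_mul, h1, one_mul, smul_eq_mul]
  rw [mul_sub]

theorem hasFDerivAt_gibbsMean (hw : ∀ k, 0 ≤ w k) (hw' : ∃ k, 0 < w k) :
    HasFDerivAt (gibbsMean a w)
      (LinearMap.toContinuousLinearMap (Matrix.toLin' (gibbsCov a w x))) x := by
  have h1 : HasFDerivAt (gibbsMean a w) (∑ k, (gibbs a w x k • (dotCLM (a k) -
      dotCLM (gibbsMean a w x))).smulRight (a k)) x :=
    HasFDerivAt.fun_sum fun k _ => (hasFDerivAt_gibbs x hw hw' k).smul_const (a k)
  convert h1 using 1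
  ext1 h
  simp only [LinearMap.coe_toContinuousLinearMap', Matrix.toLin'_apply,
    gibbsCov_mulVec x hw hw' h, sum_apply]
  simp

theorem dotProduct_gibbsCov_mulVec (h : Fin n → ℝ) :
    h ⬝ᵥ (gibbsCov a w x).mulVec h =
      ∑ q : ι × ι, gibbs a w x q.1 * gibbs a w x q.2 / 2 * ((a q.1 - a q.2) ⬝ᵥ h) ^ 2 := by
  rw [gibbsCov, Matrix.sum_mulVec, dotProduct_sum]
  refine Finset.sum_congr rfl fun q _ => ?_
  rw [Matrix.smul_mulVec, Matrix.vecMulVec_mulVec, dotProduct_smul, op_smul_eq_smul,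
    dotProduct_smul, dotProduct_comm h, smul_eq_mul, smul_eq_mul]
  ring

theorem dotProduct_gibbsCov_mulVec_pos (hw : ∀ k, 0 ≤ w k) {h : Fin n → ℝ}
    (hh : ∃ k l, 0 < w k ∧ 0 < w l ∧ a k ⬝ᵥ h ≠ a l ⬝ᵥ h) :
    0 < h ⬝ᵥ (gibbsCov a w x).mulVec h := by
  obtain ⟨k, l, hk, hl, hkl⟩ := hh
  rw [dotProduct_gibbsCov_mulVec]
  refine Finset.sum_pos' (fun q _ => ?_) ⟨(k, l), Finset.mem_univ _, ?_⟩
  · have := gibbs_nonneg (a := a) x hw q.1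
    have := gibbs_nonneg (a := a) x hw q.2
    positivity
  · have h1 : 0 < gibbs a w x k := mul_pos hk (Real.exp_pos _)
    have h2 : 0 < gibbs a w x l := mul_pos hl (Real.exp_pos _)
    have h3 : (a k - a l) ⬝ᵥ h ≠ 0 := by rwa [sub_dotProduct, sub_ne_zero]
    positivity

theorem gibbsMean_mem_convexHull (hw : ∀ k, 0 ≤ w k) (hw' : ∃ k, 0 < w k) :
    gibbsMean a w x ∈ convexHull ℝ (a '' {k | 0 < w k}) := by
  classical
  have h1 := sum_gibbs (a := a) x hw hw'
  have h0 : ∀ k ∉ Finset.univ.filter (fun k => 0 < w k), gibbs a w x k = 0 := by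
    intro k hk
    have : w k = 0 := le_antisymm (by simpa using hk) (hw k)
    simp [gibbs, this]
  have e1 : gibbsMean a w x = ∑ k ∈ Finset.univ.filter (fun k => 0 < w k), gibbs a w x k • a k := by
    rw [gibbsMean]
    refine (Finset.sum_subset (Finset.subset_univ _) fun k _ hk => ?_).symm
    rw [h0 k hk, zero_smul]
  rw [e1]
  refine (convex_convexHull ℝ _).sum_mem (fun k _ => gibbs_nonneg x hw k) ?_ fun k hk =>
    subset_convexHull ℝ _ ⟨k, by simpa using hk, rfl⟩
  rw [← h1]
  exact Finset.sum_subset (Finset.subset_univ _) fun k _ hk => h0 k hk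

/-- The function `log (expSum a w)` lies within a bounded distance above the support function of
the Newton polytope. -/
theorem exists_add_dotProduct_le_log_expSum (hw : ∀ k, 0 ≤ w k) :
    ∃ K : ℝ, ∀ p ∈ convexHull ℝ (a '' {k | 0 < w k}), ∀ x,
      K + p ⬝ᵥ x ≤ Real.log (expSum a w x) := by
  obtain ⟨K, hK⟩ : BddBelow (Set.range fun k => Real.log (w k)) := (Set.finite_range _).bddBelow
  refine ⟨K, fun p hp x => ?_⟩
  have hconv : Convex ℝ {p : Fin n → ℝ | p ⬝ᵥ x ≤ Real.log (expSum a w x) - K} := by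
    have := convex_halfSpace_le (𝕜 := ℝ) (f := fun p : Fin n → ℝ => p ⬝ᵥ x)
      ⟨fun p q => add_dotProduct p q x, fun c p => smul_dotProduct c p x⟩
      (Real.log (expSum a w x) - K)
    exact this
  have hsub : a '' {k | 0 < w k} ⊆ {p : Fin n → ℝ | p ⬝ᵥ x ≤ Real.log (expSum a w x) - K} := by
    rintro _ ⟨k, hk, rfl⟩
    have h1 : w k * Real.exp (a k ⬝ᵥ x) ≤ expSum a w x :=
      Finset.single_le_sum (f := fun k => w k * Real.exp (a k ⬝ᵥ x))
        (fun k _ => mul_nonneg (hw k) (Real.exp_nonneg _)) (Finset.mem_univ k)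
    have h2 := Real.log_le_log (mul_pos hk (Real.exp_pos _)) h1
    rw [Real.log_mul (ne_of_gt hk) (Real.exp_pos _).ne', Real.log_exp] at h2
    have h3 := hK ⟨k, rfl⟩
    simp only [Set.mem_ofPred_eq] at h3 ⊢
    linarith
  have := convexHull_min hsub hconv hp
  simp only [Set.mem_ofPred_eq] at this
  linarith

end Gibbs

end

end RelMixedVolume

/-! ### Mixed volumes of polytopes as integrals, and their monotonicity -/

namespace RelMixedVolume

open Filter Topology

noncomputable section

theorem isCompact_finset_sum {n : ℕ} {κ : Type*} {K : κ → Set (Fin n → ℝ)} (I : Finset κ)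
    (h : ∀ i ∈ I, IsCompact (K i)) : IsCompact (∑ i ∈ I, K i) := by
  classical
  induction I using Finset.induction_on with
  | empty => exact isCompact_singleton (x := (0 : Fin n → ℝ))
  | insert i I hi ih =>
    rw [Finset.sum_insert hi]
    exact (h i (Finset.mem_insert_self i I)).add
      (ih fun j hj => h j (Finset.mem_insert_of_mem hj))

section MomentMap

/-- The Newton polytope of an exponential sum: the convex hull of the exponents that carry a
positive weight. -/
def newton {n : ℕ} {ι : Type*} (a : ι → Fin n → ℝ) (w : ι → ℝ) : Set (Fin n → ℝ) :=
  convexHull ℝ (a '' {k | 0 < w k})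

/-- The exponents of positive weight affinely span the space: no nonzero linear functional is
constant on them. -/
def Spanning {n : ℕ} {ι : Type*} (a : ι → Fin n → ℝ) (w : ι → ℝ) : Prop :=
  ∀ h : Fin n → ℝ, h ≠ 0 → ∃ k l, 0 < w k ∧ 0 < w l ∧ a k ⬝ᵥ h ≠ a l ⬝ᵥ h

theorem Spanning.exists_pos {n : ℕ} [NeZero n] {ι : Type*} {a : ι → Fin n → ℝ} {w : ι → ℝ}
    (h : Spanning a w) : ∃ k, 0 < w k := by
  obtain ⟨k, _, hk, _⟩ := h (fun _ => 1) (fun h => one_ne_zero (congrFun h 0))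
  exact ⟨k, hk⟩

variable {n : ℕ} {ι : Type*} [Fintype ι] {a : ι → Fin n → ℝ} {w : Fin n → ι → ℝ}

theorem hasFDerivAt_sum_gibbsMean (hw : ∀ i k, 0 ≤ w i k) (hw' : ∀ i, ∃ k, 0 < w i k)
    (I : Finset (Fin n)) (x : Fin n → ℝ) :
    HasFDerivAt (fun x => ∑ i ∈ I, gibbsMean a (w i) x)
      (LinearMap.toContinuousLinearMap (Matrix.toLin' (∑ i ∈ I, gibbsCov a (w i) x))) x := by
  have h := HasFDerivAt.fun_sum (u := I) fun i _ =>
    hasFDerivAt_gibbsMean (a := a) x (hw i) (hw' i)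
  rwa [← map_sum, ← map_sum] at h

/-- The gradient of a strictly convex function is injective. -/
theorem injective_sum_gibbsMean (hw : ∀ i k, 0 ≤ w i k) (hw' : ∀ i, ∃ k, 0 < w i k)
    (hs : ∀ i, Spanning a (w i)) {I : Finset (Fin n)} (hI : I.Nonempty) :
    Function.Injective fun x => ∑ i ∈ I, gibbsMean a (w i) x := by
  intro x y hxy
  by_contra hne
  have hh : y - x ≠ 0 := sub_ne_zero.2 (Ne.symm hne)
  set h := y - x with hdef
  let g : ℝ → ℝ := fun t => dotCLM h (∑ i ∈ I, gibbsMean a (w i) (x + t • h))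
  have hg : ∀ t, HasDerivAt g (h ⬝ᵥ (∑ i ∈ I, gibbsCov a (w i) (x + t • h)).mulVec h) t := by
    intro t
    have h1 : HasDerivAt (fun t : ℝ => x + t • h) h t := by
      simpa using ((hasDerivAt_id t).smul_const h).const_add x
    have h2 := (hasFDerivAt_sum_gibbsMean (a := a) hw hw' I (x + t • h)).comp_hasDerivAt t h1
    have h3 := (dotCLM h).hasFDerivAt.comp_hasDerivAt t h2
    simpa only [LinearMap.coe_toContinuousLinearMap', Matrix.toLin'_apply, dotCLM_apply] using! h3
  have hmono : StrictMono g := by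
    refine strictMono_of_deriv_pos fun t => ?_
    rw [(hg t).deriv, Matrix.sum_mulVec, dotProduct_sum]
    exact Finset.sum_pos (fun i _ => dotProduct_gibbsCov_mulVec_pos _ (hw i) (hs i h hh)) hI
  have h01 := hmono zero_lt_one
  have hxy' : ∑ i ∈ I, gibbsMean a (w i) x = ∑ i ∈ I, gibbsMean a (w i) y := hxy
  simp only [g, zero_smul, add_zero, one_smul, hdef, add_sub_cancel, hxy', lt_self_iff_false] at h01

theorem range_sum_gibbsMean_subset (hw : ∀ i k, 0 ≤ w i k) (hw' : ∀ i, ∃ k, 0 < w i k)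
    (I : Finset (Fin n)) :
    Set.range (fun x => ∑ i ∈ I, gibbsMean a (w i) x) ⊆ ∑ i ∈ I, newton a (w i) := by
  rintro _ ⟨x, rfl⟩
  exact Set.finsetSum_mem_finsetSum I _ _ fun i _ => gibbsMean_mem_convexHull x (hw i) (hw' i)

/-- Every interior point `y` of the Minkowski sum is attained: the function
`∑ log (expSum a (w i)) - y ⬝ᵥ ·` is coercive, and its gradient vanishes at its minimum. -/
theorem interior_subset_range_sum_gibbsMean [NeZero n] (hw : ∀ i k, 0 ≤ w i k)
    (hw' : ∀ i, ∃ k, 0 < w i k) (I : Finset (Fin n)) :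
    interior (∑ i ∈ I, newton a (w i)) ⊆ Set.range (fun x => ∑ i ∈ I, gibbsMean a (w i) x) := by
  intro y hy
  set ψ : (Fin n → ℝ) → ℝ := fun x => ∑ i ∈ I, Real.log (expSum a (w i) x) - dotCLM y x with hψ
  have hd : ∀ x, HasFDerivAt ψ (∑ i ∈ I, dotCLM (gibbsMean a (w i) x) - dotCLM y) x := fun x =>
    (HasFDerivAt.fun_sum fun i _ => hasFDerivAt_log_expSum x (hw i) (hw' i)).sub
      (dotCLM y).hasFDerivAt
  have hcont : Continuous ψ := continuous_iff_continuousAt.2 fun x => (hd x).continuousAt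
  choose K hK using fun i => exists_add_dotProduct_le_log_expSum (a := a) (hw i)
  have hlow : ∀ p ∈ ∑ i ∈ I, newton a (w i), ∀ x,
      ∑ i ∈ I, K i + p ⬝ᵥ x ≤ ∑ i ∈ I, Real.log (expSum a (w i) x) := by
    intro p hp x
    obtain ⟨g, hg, rfl⟩ := (Set.mem_finsetSum I _ p).1 hp
    rw [sum_dotProduct, ← Finset.sum_add_distrib]
    exact Finset.sum_le_sum fun i hi => hK i _ (hg hi) x
  obtain ⟨ε, hε, hball⟩ := Metric.isOpen_iff.1 isOpen_interior y hy
  have hcoord : ∀ x j, ∑ i ∈ I, K i + ε / 2 * |x j| ≤ ψ x := by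
    intro x j
    have hmem : ∀ s : ℝ, |s| = 1 → y + Pi.single j (s * (ε / 2)) ∈ ∑ i ∈ I, newton a (w i) := by
      intro s hs
      refine interior_subset (hball ?_)
      rw [Metric.mem_ball, dist_eq_norm, add_sub_cancel_left, Pi.norm_single, norm_mul,
        Real.norm_eq_abs, hs, one_mul, Real.norm_eq_abs, abs_of_pos (by positivity)]
      linarith
    obtain ⟨s, hs, hsx⟩ : ∃ s : ℝ, |s| = 1 ∧ |x j| = s * x j := by
      rcases abs_cases (x j) with ⟨h, _⟩ | ⟨h, _⟩
      · exact ⟨1, by simp, by simp [h]⟩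
      · exact ⟨-1, by simp, by simp [h]⟩
    have h := hlow _ (hmem s hs) x
    rw [add_dotProduct, single_dotProduct] at h
    simp only [hψ, dotCLM_apply, hsx]
    linarith
  have hlim : Tendsto ψ (cocompact (Fin n → ℝ)) atTop := by
    have h1 : Tendsto (fun x : Fin n → ℝ => ∑ i ∈ I, K i + ε / 2 * ‖x‖)
        (cocompact (Fin n → ℝ)) atTop :=
      tendsto_atTop_add_const_left _ _
        ((tendsto_norm_cocompact_atTop).const_mul_atTop (by positivity))
    refine tendsto_atTop_mono (fun x => ?_) h1
    obtain ⟨j, -, hj⟩ := Finset.exists_max_image Finset.univ (fun j => ‖x j‖) ⟨0, Finset.mem_univ 0⟩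
    have hx : ‖x‖ ≤ |x j| := (pi_norm_le_iff_of_nonneg (abs_nonneg _)).2 fun i =>
      hj i (Finset.mem_univ i)
    have := hcoord x j
    have := mul_le_mul_of_nonneg_left hx (half_pos hε).le
    linarith
  obtain ⟨x, hx⟩ := hcont.exists_forall_le hlim
  refine ⟨x, ?_⟩
  have h0 := IsLocalMin.hasFDerivAt_eq_zero (f := ψ) (Filter.Eventually.of_forall hx) (hd x)
  funext j
  have := congrArg (fun L : (Fin n → ℝ) →L[ℝ] ℝ => L (Pi.single j 1)) h0
  simpa [sub_eq_zero] using this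

theorem det_sum_gibbsCov_nonneg (hw : ∀ i k, 0 ≤ w i k) (I : Finset (Fin n)) (x : Fin n → ℝ) :
    0 ≤ (∑ i ∈ I, gibbsCov a (w i) x).det := by
  have e : ∑ i ∈ I, gibbsCov a (w i) x = ∑ q : ι × ι,
      (∑ i ∈ I, gibbs a (w i) x q.1 * gibbs a (w i) x q.2 / 2) •
        Matrix.vecMulVec (a q.1 - a q.2) (a q.1 - a q.2) := by
    simp only [gibbsCov]
    rw [Finset.sum_comm]
    exact Finset.sum_congr rfl fun q _ => (Finset.sum_smul).symm
  have hpos : (0 : ℝ) < n ! := by positivity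
  refine nonneg_of_mul_nonneg_right (a := (n ! : ℝ)) ?_ hpos
  rw [e, factorial_mul_det_sum_vecMulVec]
  refine Finset.sum_nonneg fun f _ => mul_nonneg (Finset.prod_nonneg fun k _ =>
    Finset.sum_nonneg fun i _ => ?_) (sq_nonneg _)
  have := gibbs_nonneg (a := a) x (hw i) (f k).1
  have := gibbs_nonneg (a := a) x (hw i) (f k).2
  positivity

/-- The volume of a Minkowski sum of Newton polytopes is the integral of the Jacobian of the
gradient map, by the change of variables formula. -/
theorem volume_sum_newton [NeZero n] (hw : ∀ i k, 0 ≤ w i k) (hs : ∀ i, Spanning a (w i))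
    (I : Finset (Fin n)) :
    volume (∑ i ∈ I, newton a (w i)) =
      ∫⁻ x, ENNReal.ofReal (∑ i ∈ I, gibbsCov a (w i) x).det := by
  rcases I.eq_empty_or_nonempty with rfl | hI
  -- the empty sum is a point, and the determinant of the zero matrix vanishes since `n ≠ 0`
  · have : Nonempty (Fin n) := ⟨0⟩
    have e : volume (0 : Set (Fin n → ℝ)) = 0 := measure_singleton (0 : Fin n → ℝ)
    simp [Matrix.det_zero, e]
  have hw' := fun i => (hs i).exists_pos
  have h1 := lintegral_abs_det_fderiv_eq_addHaar_image volume MeasurableSet.univ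
    (fun x _ => (hasFDerivAt_sum_gibbsMean (a := a) hw hw' I x).hasFDerivWithinAt)
    (injective_sum_gibbsMean hw hw' hs hI).injOn
  rw [Set.image_univ, Measure.restrict_univ] at h1
  have h2 : volume (∑ i ∈ I, newton a (w i)) =
      volume (Set.range fun x => ∑ i ∈ I, gibbsMean a (w i) x) := by
    refine le_antisymm ?_ (measure_mono (range_sum_gibbsMean_subset hw hw' I))
    calc volume (∑ i ∈ I, newton a (w i))
        ≤ volume (interior (∑ i ∈ I, newton a (w i)) ∪ frontier (∑ i ∈ I, newton a (w i))) := by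
          refine measure_mono fun y hy => ?_
          by_cases h : y ∈ interior (∑ i ∈ I, newton a (w i))
          · exact Or.inl h
          · exact Or.inr ⟨subset_closure hy, h⟩
      _ ≤ volume (interior (∑ i ∈ I, newton a (w i))) +
          volume (frontier (∑ i ∈ I, newton a (w i))) := measure_union_le _ _
      _ = volume (interior (∑ i ∈ I, newton a (w i))) := by
          have hconv : Convex ℝ (∑ i ∈ I, newton a (w i)) :=
            convex_sum _ fun i _ => convex_convexHull ℝ _
          rw [hconv.addHaar_frontier volume, add_zero]
      _ ≤ _ := measure_mono (interior_subset_range_sum_gibbsMean hw hw' I)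
  rw [h2, ← h1]
  refine lintegral_congr fun x => ?_
  rw [ContinuousLinearMap.det, LinearMap.coe_toContinuousLinearMap, LinearMap.det_toLin',
    abs_of_nonneg (det_sum_gibbsCov_nonneg hw I x)]

theorem continuous_gibbsCov {w : ι → ℝ} (hw : ∀ k, 0 ≤ w k) (hw' : ∃ k, 0 < w k) :
    Continuous (gibbsCov a w) := by
  have h : ∀ k, Continuous fun x => gibbs a w x k := fun k =>
    continuous_iff_continuousAt.2 fun x => (hasFDerivAt_gibbs x hw hw' k).continuousAt
  unfold gibbsCov
  fun_prop

theorem continuous_mixedDiscriminant :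
    Continuous (mixedDiscriminant : (Fin n → Matrix (Fin n) (Fin n) ℝ) → ℝ) := by
  unfold mixedDiscriminant
  fun_prop

theorem mixedDiscriminant_gibbsCov_nonneg (hw : ∀ i k, 0 ≤ w i k) (x : Fin n → ℝ) :
    0 ≤ mixedDiscriminant fun i => gibbsCov a (w i) x := by
  unfold gibbsCov
  refine mixedDiscriminant_nonneg
    (fun i q => gibbs a (w i) x q.1 * gibbs a (w i) x q.2 / 2) (fun i q => ?_)
    (fun q : ι × ι => a q.1 - a q.2)
  have := gibbs_nonneg (a := a) x (hw i) q.1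
  have := gibbs_nonneg (a := a) x (hw i) q.2
  positivity

/-- The mixed volume of the Newton polytopes is the integral of the mixed discriminant of the
Hessians. -/
theorem integral_mixedDiscriminant [NeZero n] (hw : ∀ i k, 0 ≤ w i k)
    (hs : ∀ i, Spanning a (w i)) :
    (Integrable fun x => mixedDiscriminant fun i => gibbsCov a (w i) x) ∧
    ∫ x, mixedDiscriminant (fun i => gibbsCov a (w i) x) =
      ∑ I : Finset (Fin n),
        (-1 : ℝ) ^ (n - I.card) * volume.real (∑ i ∈ I, newton a (w i)) := by
  have hw' := fun i => (hs i).exists_pos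
  have hcont : ∀ I : Finset (Fin n), Continuous fun x => (∑ i ∈ I, gibbsCov a (w i) x).det :=
    fun I => (continuous_finsetSum I fun i _ => continuous_gibbsCov (hw i) (hw' i)).matrix_det
  have hint : ∀ I : Finset (Fin n),
      Integrable fun x => (∑ i ∈ I, gibbsCov a (w i) x).det := by
    intro I
    refine (lintegral_ofReal_ne_top_iff_integrable (hcont I).aestronglyMeasurable
      (Eventually.of_forall fun x => det_sum_gibbsCov_nonneg hw I x)).1 ?_
    rw [← volume_sum_newton hw hs]
    exact (isCompact_finset_sum I fun i _ =>
      (Set.toFinite _).isCompact_convexHull (𝕜 := ℝ)).measure_lt_top.ne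
  have hval : ∀ I : Finset (Fin n), ∫ x, (∑ i ∈ I, gibbsCov a (w i) x).det =
      volume.real (∑ i ∈ I, newton a (w i)) := by
    intro I
    rw [integral_eq_lintegral_of_nonneg_ae (Eventually.of_forall fun x =>
      det_sum_gibbsCov_nonneg hw I x) (hcont I).aestronglyMeasurable, ← volume_sum_newton hw hs]
    rfl
  unfold mixedDiscriminant
  refine ⟨integrable_finsetSum _ fun I _ => (hint I).const_mul _, ?_⟩
  rw [integral_finsetSum _ fun I _ => (hint I).const_mul _]
  refine Finset.sum_congr rfl fun I _ => ?_
  rw [integral_const_mul, hval]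

theorem lintegral_mixedDiscriminant [NeZero n] (hw : ∀ i k, 0 ≤ w i k)
    (hs : ∀ i, Spanning a (w i)) :
    ∫⁻ x, ENNReal.ofReal (mixedDiscriminant fun i => gibbsCov a (w i) x) =
      ENNReal.ofReal (∑ I : Finset (Fin n),
        (-1 : ℝ) ^ (n - I.card) * volume.real (∑ i ∈ I, newton a (w i))) := by
  rw [← ofReal_integral_eq_lintegral_ofReal (integral_mixedDiscriminant hw hs).1
    (Eventually.of_forall fun x => mixedDiscriminant_gibbsCov_nonneg hw x),
    (integral_mixedDiscriminant hw hs).2]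

theorem tendsto_gibbsCov {w : ℕ → ι → ℝ} {w₀ : ι → ℝ} (h : Tendsto w atTop (𝓝 w₀))
    (hw : ∀ k, 0 ≤ w₀ k) (hw' : ∃ k, 0 < w₀ k) (x : Fin n → ℝ) :
    Tendsto (fun m => gibbsCov a (w m) x) atTop (𝓝 (gibbsCov a w₀ x)) := by
  have h1 : ∀ k, Tendsto (fun m => w m k) atTop (𝓝 (w₀ k)) := fun k => tendsto_pi_nhds.1 h k
  have h2 : Tendsto (fun m => expSum a (w m) x) atTop (𝓝 (expSum a w₀ x)) :=
    tendsto_finsetSum _ fun k _ => (h1 k).mul_const _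
  have h3 : ∀ k, Tendsto (fun m => gibbs a (w m) x k) atTop (𝓝 (gibbs a w₀ x k)) := fun k =>
    (h1 k).mul ((Real.continuous_exp.tendsto _).comp
      ((h2.log (expSum_pos x hw hw').ne').const_sub _))
  exact tendsto_finsetSum _ fun q _ => (((h3 q.1).mul (h3 q.2)).div_const 2).smul_const _

/-- The mixed volume is monotone. Weights `t → 0` on the new exponents do not change the larger
polytopes, while the mixed discriminants converge pointwise to those of the smaller ones; Fatou's
lemma compares the integrals. -/
theorem alternating_volume_convexHull_mono [NeZero n] {S T : Fin n → Set ι}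
    (hST : ∀ i, S i ⊆ T i)
    (hS : ∀ i, ∀ h : Fin n → ℝ, h ≠ 0 → ∃ k ∈ S i, ∃ l ∈ S i, a k ⬝ᵥ h ≠ a l ⬝ᵥ h) :
    ∑ I : Finset (Fin n), (-1 : ℝ) ^ (n - I.card) *
        volume.real (∑ i ∈ I, convexHull ℝ (a '' S i)) ≤
      ∑ I : Finset (Fin n), (-1 : ℝ) ^ (n - I.card) *
        volume.real (∑ i ∈ I, convexHull ℝ (a '' T i)) := by
  classical
  let w : ℝ → Fin n → ι → ℝ := fun t i k => if k ∈ S i then 1 else if k ∈ T i then t else 0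
  have hw : ∀ t, 0 ≤ t → ∀ i k, 0 ≤ w t i k := fun t ht i k => by
    simp only [w]; split_ifs <;> simp [ht]
  have hsp : ∀ t i, Spanning a (w t i) := fun t i h hh => by
    obtain ⟨k, hk, l, hl, hkl⟩ := hS i h hh
    exact ⟨k, l, by simp [w, hk], by simp [w, hl], hkl⟩
  have hw0 : ∀ i, newton a (w 0 i) = convexHull ℝ (a '' S i) := fun i => by
    unfold newton
    congr 2
    ext k
    simp only [w, Set.mem_ofPred_eq]
    split_ifs with h <;> simp [h]
  have hwt : ∀ t, 0 < t → ∀ i, newton a (w t i) = convexHull ℝ (a '' T i) := fun t ht i => by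
    unfold newton
    congr 2
    ext k
    simp only [w, Set.mem_ofPred_eq]
    by_cases h1 : k ∈ S i
    · simp [h1, hST i h1]
    · by_cases h2 : k ∈ T i <;> simp [h1, h2, ht]
  have h0 := lintegral_mixedDiscriminant (hw 0 le_rfl) (hsp 0)
  have ht := fun t (ht : 0 < t) => lintegral_mixedDiscriminant (hw t ht.le) (hsp t)
  simp only [hw0] at h0
  let s : ℕ → ℝ := fun m => 1 / ((m : ℝ) + 1)
  have hs0 : ∀ m, 0 < s m := fun m => by positivity
  have hsl : Tendsto s atTop (𝓝 0) := tendsto_one_div_add_atTop_nhds_zero_nat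
  have hlim : ∀ x, Tendsto (fun m => mixedDiscriminant fun i => gibbsCov a (w (s m) i) x) atTop
      (𝓝 (mixedDiscriminant fun i => gibbsCov a (w 0 i) x)) := by
    intro x
    refine (continuous_mixedDiscriminant.tendsto _).comp (tendsto_pi_nhds.2 fun i => ?_)
    refine tendsto_gibbsCov (tendsto_pi_nhds.2 fun k => ?_) (hw 0 le_rfl i) (hsp 0 i).exists_pos x
    simp only [w]
    split_ifs
    exacts [tendsto_const_nhds, hsl, tendsto_const_nhds]
  have hmeas : ∀ m, Measurable fun x =>
      ENNReal.ofReal (mixedDiscriminant fun i => gibbsCov a (w (s m) i) x) := fun m =>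
    (ENNReal.continuous_ofReal.comp (continuous_mixedDiscriminant.comp (continuous_pi fun i =>
      continuous_gibbsCov (hw _ (hs0 m).le i) (hsp _ i).exists_pos))).measurable
  have hnonneg : 0 ≤ ∑ I : Finset (Fin n), (-1 : ℝ) ^ (n - I.card) *
      volume.real (∑ i ∈ I, convexHull ℝ (a '' T i)) := by
    have h1 := (integral_mixedDiscriminant (hw 1 zero_le_one) (hsp 1)).2
    simp only [hwt 1 one_pos] at h1
    rw [← h1]
    exact integral_nonneg fun x => mixedDiscriminant_gibbsCov_nonneg (hw 1 zero_le_one) x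
  refine (ENNReal.ofReal_le_ofReal_iff hnonneg).1 ?_
  calc _ = ∫⁻ x, ENNReal.ofReal (mixedDiscriminant fun i => gibbsCov a (w 0 i) x) := h0.symm
    _ = ∫⁻ x, liminf (fun m => ENNReal.ofReal
          (mixedDiscriminant fun i => gibbsCov a (w (s m) i) x)) atTop :=
        lintegral_congr fun x => (ENNReal.tendsto_ofReal (hlim x)).liminf_eq.symm
    _ ≤ liminf (fun m => ∫⁻ x, ENNReal.ofReal
          (mixedDiscriminant fun i => gibbsCov a (w (s m) i) x)) atTop :=
        lintegral_liminf_le hmeas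
    _ = _ := by
        have e : ∀ m, ∫⁻ x, ENNReal.ofReal (mixedDiscriminant fun i => gibbsCov a (w (s m) i) x) =
            ENNReal.ofReal (∑ I : Finset (Fin n), (-1 : ℝ) ^ (n - I.card) *
              volume.real (∑ i ∈ I, convexHull ℝ (a '' T i))) := fun m => by
          rw [ht _ (hs0 m)]
          simp only [hwt _ (hs0 m)]
        simp only [e, liminf_const]

end MomentMap

end

end RelMixedVolume

/-! ### Truncations of Newton polyhedra -/

namespace RelMixedVolume

/-- The condition that `IsLatticeTuple` imposes on each member of a tuple. -/
def Admissible {n : ℕ} (B : Set (Fin n → ℝ)) : Prop :=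
  IsLatticePolyhedron B ∧ (orthant n, B) ∈ polyhedronPairs (supportCone (orthant n))

/-- The simplex `{x ≥ 0, ∑ x ≤ s}`. -/
def simplex (n : ℕ) (s : ℝ) : Set (Fin n → ℝ) := {x | x ∈ orthant n ∧ ∑ j, x j ≤ s}

variable {n : ℕ}

theorem convex_orthant : Convex ℝ (orthant n) := by
  intro x hx y hy a b ha hb _ j
  have := hx j
  have := hy j
  simp only [Pi.add_apply, Pi.smul_apply, smul_eq_mul]
  positivity

theorem add_mem_orthant {x y : Fin n → ℝ} (hx : x ∈ orthant n) (hy : y ∈ orthant n) :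
    x + y ∈ orthant n := fun j => add_nonneg (hx j) (hy j)

theorem smul_mem_orthant {x : Fin n → ℝ} {t : ℝ} (ht : 0 ≤ t) (hx : x ∈ orthant n) :
    t • x ∈ orthant n := fun j => mul_nonneg ht (hx j)

theorem zero_mem_orthant : (0 : Fin n → ℝ) ∈ orthant n := fun _ => le_rfl

theorem isClosed_orthant : IsClosed (orthant n) := by
  have : orthant n = ⋂ j, {x | 0 ≤ x j} := by ext; simp [orthant]
  rw [this]
  exact isClosed_iInter fun j => isClosed_le continuous_const (continuous_apply j)

theorem sum_nonneg_of_mem_orthant {x : Fin n → ℝ} (hx : x ∈ orthant n) : 0 ≤ ∑ j, x j :=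
  Finset.sum_nonneg fun j _ => hx j

theorem single_mem_orthant (j : Fin n) {t : ℝ} (ht : 0 ≤ t) : Pi.single j t ∈ orthant n := by
  intro i
  by_cases h : i = j
  · subst h; simpa using ht
  · simp [h]

theorem orthant_add_orthant : orthant n + orthant n = orthant n :=
  Set.Subset.antisymm (Set.add_subset_iff.2 fun _ hx _ hy => add_mem_orthant hx hy)
    fun x hx => ⟨x, hx, 0, zero_mem_orthant, add_zero x⟩

theorem nonneg_of_mem_supportCone_orthant {γ : Module.Dual ℝ (Fin n → ℝ)}
    (hγ : γ ∈ supportCone (orthant n)) {x : Fin n → ℝ} (hx : x ∈ orthant n) : 0 ≤ γ x := by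
  obtain ⟨c, hc⟩ := hγ
  by_contra! hneg
  have h0 : c ≤ 0 := by simpa using hc ⟨0, zero_mem_orthant, rfl⟩
  have h1 := hc ⟨((c - 1) / γ x) • x, smul_mem_orthant
    (div_nonneg_of_nonpos (by linarith) hneg.le) hx, rfl⟩
  rw [map_smul, smul_eq_mul, div_mul_cancel₀ _ hneg.ne] at h1
  linarith

theorem proj_mem_supportCone_orthant (j : Fin n) :
    LinearMap.proj j ∈ supportCone (orthant n) := by
  refine ⟨0, ?_⟩
  rintro _ ⟨x, hx, rfl⟩
  exact hx j

theorem IsPolyhedron.convex {P : Set (Fin n → ℝ)} (h : IsPolyhedron P) : Convex ℝ P := by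
  obtain ⟨s, -, -, rfl⟩ := h
  have : {x : Fin n → ℝ | ∀ h ∈ s, h.2 ≤ h.1 x} = ⋂ h ∈ s, {x | h.2 ≤ h.1 x} := by ext; simp
  rw [this]
  exact convex_iInter₂ fun h _ => convex_halfSpace_ge h.1.isLinear h.2

theorem IsPolyhedron.isClosed {P : Set (Fin n → ℝ)} (h : IsPolyhedron P) : IsClosed P := by
  obtain ⟨s, -, -, rfl⟩ := h
  have : {x : Fin n → ℝ | ∀ h ∈ s, h.2 ≤ h.1 x} = ⋂ h ∈ s, {x | h.2 ≤ h.1 x} := by ext; simp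
  rw [this]
  exact isClosed_biInter fun h _ =>
    isClosed_le continuous_const h.1.continuous_of_finiteDimensional

namespace Admissible

variable {B : Set (Fin n → ℝ)}

theorem isPolyhedron (hB : Admissible B) : IsPolyhedron B := hB.1.1

theorem supportCone_eq (hB : Admissible B) : supportCone B = supportCone (orthant n) :=
  hB.2.2.2.2.1

/-- The functionals cutting out `B` are bounded below on `B`, hence nonnegative on the orthant. -/
theorem add_mem (hB : Admissible B) {x c : Fin n → ℝ} (hx : x ∈ B) (hc : c ∈ orthant n) :
    x + c ∈ B := by
  obtain ⟨s, -, -, hs⟩ := hB.isPolyhedron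
  rw [hs] at hx ⊢
  intro h hh
  have h1 : h.1 ∈ supportCone (orthant n) := by
    rw [← hB.supportCone_eq, hs]
    refine ⟨h.2, ?_⟩
    rintro _ ⟨y, hy, rfl⟩
    exact hy h hh
  have := nonneg_of_mem_supportCone_orthant h1 hc
  rw [map_add]
  linarith [hx h hh]

theorem nonempty [NeZero n] (hB : Admissible B) : B.Nonempty := by
  rw [Set.nonempty_iff_ne_empty]
  rintro rfl
  have h1 : -LinearMap.proj (0 : Fin n) ∈ supportCone (orthant n) := by
    rw [← hB.supportCone_eq]
    simp [supportCone]
  have := nonneg_of_mem_supportCone_orthant h1 (single_mem_orthant (0 : Fin n) zero_le_one)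
  norm_num at this

/-- In dimension at least two, bounded symmetric difference forces `B` into the orthant: a point
of `B` with a negative coordinate can be moved to infinity along another coordinate axis. -/
theorem subset_orthant (hn : 2 ≤ n) (hB : Admissible B) : B ⊆ orthant n := by
  intro x hx j
  by_contra! hneg
  have : Nontrivial (Fin n) := Fin.nontrivial_iff_two_le.2 hn
  obtain ⟨k, hk⟩ := exists_ne j
  obtain ⟨r, hr⟩ := (Metric.isBounded_iff_subset_closedBall 0).1 hB.2.2.2.2.2
  have hmem : x + Pi.single k (|r| + |x k| + 1) ∈ symmDiff (orthant n) B := by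
    refine Or.inr ⟨hB.add_mem hx (single_mem_orthant k (by positivity)), fun h => ?_⟩
    have := h j
    simp [hk.symm] at this
    linarith
  have h1 := hr hmem
  rw [mem_closedBall_zero_iff] at h1
  have h2 := (norm_le_pi_norm _ k).trans h1
  rw [Pi.add_apply, Pi.single_eq_same, Real.norm_eq_abs] at h2
  have := le_abs_self (x k + (|r| + |x k| + 1))
  have := neg_abs_le (x k)
  have := le_abs_self r
  linarith

theorem exists_sum_lt (hB : Admissible B) :
    ∃ R : ℕ, ∀ x ∈ orthant n, x ∉ B → ∑ j, x j < R := by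
  obtain ⟨r, hr⟩ := (Metric.isBounded_iff_subset_closedBall 0).1 hB.2.2.2.2.2
  obtain ⟨R, hR⟩ := exists_nat_gt (∑ _j : Fin n, r)
  refine ⟨R, fun x hx hxB => lt_of_le_of_lt (Finset.sum_le_sum fun j _ => ?_) hR⟩
  have h1 := hr (Or.inl ⟨hx, hxB⟩ : x ∈ symmDiff (orthant n) B)
  rw [mem_closedBall_zero_iff] at h1
  exact (le_abs_self _).trans ((norm_le_pi_norm x j).trans h1)

end Admissible

theorem convex_simplex (s : ℝ) : Convex ℝ (simplex n s) := by
  have h : Convex ℝ {x : Fin n → ℝ | ∑ j, x j ≤ s} := by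
    have := convex_halfSpace_le (𝕜 := ℝ) (f := fun x : Fin n → ℝ => ∑ j, x j)
      ⟨fun x y => by simp [Finset.sum_add_distrib], fun c x => by simp [Finset.mul_sum]⟩ s
    exact this
  exact convex_orthant.inter h

theorem isCompact_simplex (s : ℝ) : IsCompact (simplex n s) := by
  refine Metric.isCompact_of_isClosed_isBounded ?_ ?_
  · exact isClosed_orthant.inter (isClosed_le (f := fun x : Fin n → ℝ => ∑ j, x j)
      (by fun_prop) continuous_const)
  · refine (Metric.isBounded_iff_subset_closedBall 0).2 ⟨|s|, fun x hx => ?_⟩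
    rw [mem_closedBall_zero_iff, pi_norm_le_iff_of_nonneg (abs_nonneg s)]
    intro j
    rw [Real.norm_eq_abs, abs_of_nonneg (hx.1 j)]
    exact (Finset.single_le_sum (fun i _ => hx.1 i) (Finset.mem_univ j)).trans
      (hx.2.trans (le_abs_self s))

/-- The lattice points of the cube `[0, R]ⁿ`. -/
def cubePoint (n R : ℕ) (k : Fin n → Fin (R + 1)) : Fin n → ℝ := fun j => ((k j : ℕ) : ℝ)

/-- The indices of the lattice points of `B` in the simplex of size `R`. -/
def truncation (R : ℕ) (B : Set (Fin n → ℝ)) : Set (Fin n → Fin (R + 1)) :=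
  {k | cubePoint n R k ∈ B ∩ simplex n R}

theorem image_cubePoint_truncation (R : ℕ) (B : Set (Fin n → ℝ)) :
    cubePoint n R '' truncation R B = B ∩ simplex n R ∩ latticePoints n := by
  ext x
  constructor
  · rintro ⟨k, hk, rfl⟩
    exact ⟨hk, fun j => ⟨(k j : ℕ), by simp [cubePoint]⟩⟩
  · rintro ⟨⟨hB, hx⟩, hl⟩
    choose m hm using hl
    have h0 : ∀ j, 0 ≤ m j := fun j => by
      have := hx.1 j
      rw [hm] at this
      exact_mod_cast this
    have h1 : ∀ j, m j ≤ R := fun j => by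
      have := (Finset.single_le_sum (fun i _ => hx.1 i) (Finset.mem_univ j)).trans hx.2
      rw [hm] at this
      exact_mod_cast this
    have e : cubePoint n R (fun j => ⟨(m j).toNat, by have := h0 j; have := h1 j; omega⟩) = x := by
      funext j
      simp only [cubePoint, hm j]
      have := Int.toNat_of_nonneg (h0 j)
      exact_mod_cast this
    refine ⟨_, ?_, e⟩
    simp only [truncation, Set.mem_ofPred_eq, e]
    exact ⟨hB, hx⟩

theorem mem_convexHull_single {R : ℝ} (hR : 0 < R) {x : Fin n → ℝ} (hx : x ∈ orthant n)
    (hsum : ∑ j, x j = R) :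
    x ∈ convexHull ℝ (Set.range fun j : Fin n => (Pi.single j R : Fin n → ℝ)) := by
  have e : x = ∑ j, (x j / R) • (Pi.single j R : Fin n → ℝ) := by
    funext i
    rw [Finset.sum_apply, Finset.sum_eq_single i]
    · simp [hR.ne']
    · intro j _ hj
      simp [hj.symm]
    · simp
  rw [e]
  refine (convex_convexHull ℝ _).sum_mem (fun j _ => div_nonneg (hx j) hR.le) ?_
    fun j _ => subset_convexHull ℝ _ ⟨j, rfl⟩
  rw [← Finset.sum_div, hsum, div_self hR.ne']

theorem single_mem_latticePoints (j : Fin n) (R : ℕ) :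
    (Pi.single j (R : ℝ) : Fin n → ℝ) ∈ latticePoints n := by
  intro i
  by_cases h : i = j
  · subst h; exact ⟨R, by simp⟩
  · exact ⟨0, by simp [h]⟩

namespace Admissible

variable {B : Set (Fin n → ℝ)} {R : ℕ}

theorem single_mem (hR : ∀ x ∈ orthant n, x ∉ B → ∑ j, x j < R) (j : Fin n) {t : ℝ}
    (ht : R ≤ t) : Pi.single j t ∈ B := by
  have h0 : (0 : ℝ) ≤ R := Nat.cast_nonneg R
  by_contra h
  have := hR _ (single_mem_orthant j (h0.trans ht)) h
  simp at this
  linarith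

/-- An extreme point of the truncation of `B` by the simplex of size `R` is an extreme point of
`B` or a vertex of the simplex. -/
theorem extremePoints_inter_simplex_subset (hB : Admissible B) (hBC : B ⊆ orthant n)
    (hR : ∀ x ∈ orthant n, x ∉ B → ∑ j, x j < R) (hR0 : 0 < R) :
    (B ∩ simplex n R).extremePoints ℝ ⊆ latticePoints n := by
  intro x hx
  have hR0' : (0 : ℝ) < R := Nat.cast_pos.2 hR0
  obtain ⟨⟨hxB, hxC, hxR⟩, hext⟩ := mem_extremePoints.1 hx
  rcases hxR.lt_or_eq with hlt | heq
  · refine hB.1.2 (mem_extremePoints_iff_left.2 ⟨hxB, fun y hy z hz hxyz => ?_⟩)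
    -- shrink the segment towards `x` until it lies in the simplex
    have hy0 := sum_nonneg_of_mem_orthant (hBC hy)
    have hz0 := sum_nonneg_of_mem_orthant (hBC hz)
    have hx0 := sum_nonneg_of_mem_orthant hxC
    set D : ℝ := R - ∑ j, x j + ∑ j, y j + ∑ j, z j with hD
    set ε : ℝ := (R - ∑ j, x j) / D with hε
    have hD0 : 0 < D := by linarith
    have hε0 : 0 < ε := div_pos (by linarith) hD0
    have hε1 : ε ≤ 1 := (div_le_one hD0).2 (by linarith)
    have hεD : ε * D = R - ∑ j, x j := div_mul_cancel₀ _ hD0.ne'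
    have hmem : ∀ v ∈ B, ∑ j, v j ≤ D → x + ε • (v - x) ∈ B ∩ simplex n R := by
      intro v hv hvD
      have h1 : x + ε • (v - x) ∈ B :=
        hB.isPolyhedron.convex.add_smul_sub_mem hxB hv ⟨hε0.le, hε1⟩
      refine ⟨h1, hBC h1, ?_⟩
      have h2 : ∑ j, (x + ε • (v - x)) j = ∑ j, x j + ε * (∑ j, v j - ∑ j, x j) := by
        simp [Finset.sum_add_distrib, Finset.mul_sum, Finset.sum_sub_distrib, mul_sub]
      rw [h2]
      have h3 : ε * (∑ j, v j - ∑ j, x j) ≤ ε * D :=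
        mul_le_mul_of_nonneg_left (by linarith) hε0.le
      linarith
    have hseg : x ∈ openSegment ℝ (x + ε • (y - x)) (x + ε • (z - x)) := by
      obtain ⟨α, β, hα, hβ, hαβ, hx'⟩ := hxyz
      refine ⟨α, β, hα, hβ, hαβ, ?_⟩
      have : α • (x + ε • (y - x)) + β • (x + ε • (z - x)) =
          (α + β) • x + ε • ((α • y + β • z) - (α + β) • x) := by
        module
      rw [this, hx', hαβ, one_smul, sub_self, smul_zero, add_zero]
    have h := (hext _ (hmem y hy (by linarith)) _ (hmem z hz (by linarith)) hseg).1
    have h' : ε • (y - x) = 0 := by simpa using h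
    exact sub_eq_zero.1 ((smul_eq_zero.1 h').resolve_left hε0.ne')
  · have hsub : Set.range (fun j : Fin n => (Pi.single j (R : ℝ) : Fin n → ℝ)) ⊆
        B ∩ simplex n R := by
      rintro _ ⟨j, rfl⟩
      exact ⟨single_mem hR j le_rfl, single_mem_orthant j hR0'.le, by simp⟩
    have hconv : Convex ℝ (B ∩ simplex n R) := hB.isPolyhedron.convex.inter (convex_simplex _)
    have h1 := inter_extremePoints_subset_extremePoints_of_subset (𝕜 := ℝ)
      (convexHull_min hsub hconv) ⟨mem_convexHull_single hR0' hxC heq, hx⟩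
    obtain ⟨j, rfl⟩ := extremePoints_convexHull_subset h1
    exact single_mem_latticePoints j R

theorem inter_simplex_eq_convexHull (hB : Admissible B) (hBC : B ⊆ orthant n)
    (hR : ∀ x ∈ orthant n, x ∉ B → ∑ j, x j < R) (hR0 : 0 < R) :
    B ∩ simplex n R = convexHull ℝ (cubePoint n R '' truncation R B) := by
  have hconv : Convex ℝ (B ∩ simplex n R) := hB.isPolyhedron.convex.inter (convex_simplex _)
  have hcomp : IsCompact (B ∩ simplex n R) :=
    (isCompact_simplex _).inter_left hB.isPolyhedron.isClosed
  have hsub : cubePoint n R '' truncation R B ⊆ B ∩ simplex n R := by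
    rintro _ ⟨k, hk, rfl⟩
    exact hk
  refine Set.Subset.antisymm ?_ (convexHull_min hsub hconv)
  conv_lhs => rw [← closure_convexHull_extremePoints hcomp hconv]
  refine closure_minimal (convexHull_mono ?_)
    ((Set.toFinite _).isCompact_convexHull (𝕜 := ℝ)).isClosed
  rw [image_cubePoint_truncation]
  exact fun x hx => ⟨hx.1, hB.extremePoints_inter_simplex_subset hBC hR hR0 hx⟩

theorem eq_convexHull_add_orthant [NeZero n] (hB : Admissible B) (hBC : B ⊆ orthant n)
    (hR : ∀ x ∈ orthant n, x ∉ B → ∑ j, x j < R) (hR0 : 0 < R) :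
    B = convexHull ℝ (cubePoint n R '' truncation R B) + orthant n := by
  rw [← hB.inter_simplex_eq_convexHull hBC hR hR0]
  refine Set.Subset.antisymm (fun x hx => ?_)
    (Set.add_subset_iff.2 fun x hx c hc => hB.add_mem hx.1 hc)
  have hR0' : (0 : ℝ) < R := Nat.cast_pos.2 hR0
  have hxC := hBC hx
  by_cases h : ∑ j, x j ≤ R
  · exact ⟨x, ⟨hx, hxC, h⟩, 0, zero_mem_orthant, add_zero x⟩
  · push Not at h
    have hpos : 0 < ∑ j, x j := hR0'.trans h
    set t : ℝ := R / ∑ j, x j with ht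
    have ht0 : 0 ≤ t := by positivity
    have ht1 : t ≤ 1 := (div_le_one hpos).2 h.le
    have hsum : ∑ j, (t • x) j = R := by
      simp only [Pi.smul_apply, smul_eq_mul, ← Finset.mul_sum, ht]
      exact div_mul_cancel₀ _ hpos.ne'
    refine ⟨t • x, ⟨?_, smul_mem_orthant ht0 hxC, hsum.le⟩, (1 - t) • x,
      smul_mem_orthant (by linarith) hxC, by module⟩
    by_contra hnot
    exact absurd (hR _ (smul_mem_orthant ht0 hxC) hnot) (by rw [hsum]; exact lt_irrefl _)

/-- Inclusion of polyhedra can be tested on lattice points. -/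
theorem subset_of_latticePoints_subset [NeZero n] {B' : Set (Fin n → ℝ)} (hB : Admissible B)
    (hBC : B ⊆ orthant n) (hB' : Admissible B') (h : B ∩ latticePoints n ⊆ B') : B ⊆ B' := by
  obtain ⟨R, hR⟩ := hB.exists_sum_lt
  have hR' : ∀ x ∈ orthant n, x ∉ B → ∑ j, x j < (R + 1 : ℕ) := fun x hx hxB =>
    (hR x hx hxB).trans (by exact_mod_cast Nat.lt_succ_self R)
  rw [hB.eq_convexHull_add_orthant hBC hR' R.succ_pos]
  refine Set.add_subset_iff.2 fun x hx c hc => hB'.add_mem ?_ hc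
  refine convexHull_min ?_ hB'.isPolyhedron.convex hx
  rw [image_cubePoint_truncation]
  exact fun y hy => h ⟨hy.1.1, hy.2⟩

end Admissible

/-- Adding the orthant to a convex subset `P` of a simplex that contains the far facet adds nothing
inside the simplex and everything beyond it. -/
theorem orthant_diff_add_orthant {P : Set (Fin n → ℝ)} {s : ℝ} (hs : 0 < s) (hP : Convex ℝ P)
    (hPs : P ⊆ simplex n s) (hv : ∀ j, Pi.single j s ∈ P) :
    orthant n \ (P + orthant n) = simplex n s \ P := by
  have hfacet : ∀ x ∈ orthant n, ∑ j, x j = s → x ∈ P := fun x hx hsum =>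
    convexHull_min (by rintro _ ⟨j, rfl⟩; exact hv j) hP (mem_convexHull_single hs hx hsum)
  ext x
  constructor
  · rintro ⟨hxC, hx⟩
    refine ⟨⟨hxC, ?_⟩, fun h => hx ⟨x, h, 0, zero_mem_orthant, add_zero x⟩⟩
    by_contra! hlt
    have hpos : 0 < ∑ j, x j := hs.trans hlt
    have ht1 : s / ∑ j, x j ≤ 1 := (div_le_one hpos).2 hlt.le
    refine hx ⟨(s / ∑ j, x j) • x, hfacet _ (smul_mem_orthant (by positivity) hxC) ?_,
      (1 - s / ∑ j, x j) • x, smul_mem_orthant (by linarith) hxC, by module⟩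
    simp only [Pi.smul_apply, smul_eq_mul, ← Finset.mul_sum]
    exact div_mul_cancel₀ _ hpos.ne'
  · rintro ⟨⟨hxC, hxs⟩, hx⟩
    refine ⟨hxC, ?_⟩
    rintro ⟨p, hp, c, hc, rfl⟩
    -- follow the ray from `p` through `p + c` until it meets the far facet
    have hp' := hPs hp
    have hadd : ∑ j, (p + c) j = ∑ j, p j + ∑ j, c j := by simp [Finset.sum_add_distrib]
    rw [hadd] at hxs
    rcases (sum_nonneg_of_mem_orthant hc).eq_or_lt with h0 | hpos
    · have : c = 0 := by
        funext j
        exact (Finset.sum_eq_zero_iff_of_nonneg fun i _ => hc i).1 h0.symm j (Finset.mem_univ j)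
      exact hx (by simpa [this] using hp)
    · set T : ℝ := (s - ∑ j, p j) / ∑ j, c j with hT
      have hTc : T * ∑ j, c j = s - ∑ j, p j := div_mul_cancel₀ _ hpos.ne'
      have hT1 : 1 ≤ T := (one_le_div hpos).2 (by linarith)
      have hT0 : 0 < T := by linarith
      have hend : p + T • c ∈ P := by
        refine hfacet _ (add_mem_orthant hp'.1 (smul_mem_orthant hT0.le hc)) ?_
        have : ∑ j, (p + T • c) j = ∑ j, p j + T * ∑ j, c j := by
          simp [Finset.sum_add_distrib, Finset.mul_sum]
        rw [this, hTc]
        ring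
      have := hP.add_smul_mem hp hend (t := 1 / T) ⟨by positivity, (div_le_one hT0).2 hT1⟩
      rw [smul_smul, one_div_mul_cancel hT0.ne', one_smul] at this
      exact hx this

end RelMixedVolume

/-! ### Adjoining a point to a polyhedron -/

namespace RelMixedVolume

variable {n : ℕ}

theorem exists_between_of_finite {L U : Set ℝ} (hL : L.Finite) (hU : U.Finite)
    (h : ∀ l ∈ L, ∀ u ∈ U, l ≤ u) : ∃ t, (∀ l ∈ L, l ≤ t) ∧ ∀ u ∈ U, t ≤ u := by
  rcases L.eq_empty_or_nonempty with rfl | hne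
  · obtain ⟨t, ht⟩ := hU.bddBelow
    exact ⟨t, by simp, fun u hu => ht hu⟩
  · obtain ⟨l, hl, hmax⟩ := Set.exists_max_image L id hL hne
    exact ⟨l, hmax, h l hl⟩

/-- One step of **Fourier–Motzkin elimination**: the projection along `t` of the set cut out by
finitely many inequalities `t * d + c ≤ γ x` is again cut out by finitely many inequalities. -/
theorem exists_finite_eliminate (s : Set (ℝ × ℝ × Module.Dual ℝ (Fin n → ℝ))) (hs : s.Finite) :
    ∃ s' : Set (Module.Dual ℝ (Fin n → ℝ) × ℝ), s'.Finite ∧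
      {x | ∃ t : ℝ, ∀ h ∈ s, t * h.1 + h.2.1 ≤ h.2.2 x} = {x | ∀ h ∈ s', h.2 ≤ h.1 x} := by
  refine ⟨(fun h => (h.2.2, h.2.1)) '' {h ∈ s | h.1 = 0} ∪
    (fun p : (ℝ × ℝ × Module.Dual ℝ (Fin n → ℝ)) × (ℝ × ℝ × Module.Dual ℝ (Fin n → ℝ)) =>
      (p.1.1 • p.2.2.2 - p.2.1 • p.1.2.2, p.1.1 * p.2.2.1 - p.2.1 * p.1.2.1)) ''
      ({h ∈ s | 0 < h.1} ×ˢ {h ∈ s | h.1 < 0}),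
    ((hs.subset (Set.sep_subset _ _)).image _).union
      (((hs.subset (Set.sep_subset _ _)).prod (hs.subset (Set.sep_subset _ _))).image _), ?_⟩
  ext x
  constructor
  · rintro ⟨t, ht⟩ h (⟨g, ⟨hg, hg0⟩, rfl⟩ | ⟨⟨p, q⟩, ⟨⟨hp, hp0⟩, ⟨hq, hq0⟩⟩, rfl⟩)
    · have := ht g hg
      rw [hg0] at this
      simpa using this
    · have h1 := mul_le_mul_of_nonneg_left (ht q hq) (le_of_lt hp0)
      have h2 := mul_le_mul_of_nonneg_left (ht p hp) (neg_nonneg.2 (le_of_lt hq0))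
      simp only [LinearMap.sub_apply, LinearMap.smul_apply, smul_eq_mul] at *
      linarith
  · intro hx
    obtain ⟨t, htL, htU⟩ := exists_between_of_finite
      (L := (fun h => (h.2.2 x - h.2.1) / h.1) '' {h ∈ s | h.1 < 0})
      (U := (fun h => (h.2.2 x - h.2.1) / h.1) '' {h ∈ s | 0 < h.1})
      ((hs.subset (Set.sep_subset _ _)).image _) ((hs.subset (Set.sep_subset _ _)).image _) (by
        rintro _ ⟨q, ⟨hq, hq0⟩, rfl⟩ _ ⟨p, ⟨hp, hp0⟩, rfl⟩
        have h := hx _ (Or.inr ⟨(p, q), ⟨⟨hp, hp0⟩, ⟨hq, hq0⟩⟩, rfl⟩)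
        simp only [LinearMap.sub_apply, LinearMap.smul_apply, smul_eq_mul] at h
        rw [div_le_iff_of_neg hq0, div_mul_eq_mul_div, div_le_iff₀ hp0]
        linarith)
    refine ⟨t, fun h hh => ?_⟩
    rcases lt_trichotomy h.1 0 with h0 | h0 | h0
    · have := htL _ ⟨h, ⟨hh, h0⟩, rfl⟩
      rw [div_le_iff_of_neg h0] at this
      linarith
    · have := hx _ (Or.inl ⟨h, ⟨hh, h0⟩, rfl⟩)
      rw [h0]
      simpa using this
    · have := htU _ ⟨h, ⟨hh, h0⟩, rfl⟩
      rw [le_div_iff₀ h0] at this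
      linarith

/-- In a nonempty set, the inequalities with zero functional hold trivially and can be dropped. -/
theorem isPolyhedron_of_finite {s : Set (Module.Dual ℝ (Fin n → ℝ) × ℝ)} (hs : s.Finite)
    (hne : {x | ∀ h ∈ s, h.2 ≤ h.1 x}.Nonempty) : IsPolyhedron {x | ∀ h ∈ s, h.2 ≤ h.1 x} := by
  obtain ⟨x₀, hx₀⟩ := hne
  refine ⟨{h ∈ s | h.1 ≠ 0}, hs.subset (Set.sep_subset _ _), fun h hh => hh.2, ?_⟩
  ext x
  refine ⟨fun hx h hh => hx h hh.1, fun hx h hh => ?_⟩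
  by_cases h0 : h.1 = 0
  · have := hx₀ h hh
    rw [h0] at this ⊢
    exact this
  · exact hx h ⟨hh, h0⟩

namespace Admissible

variable {B : Set (Fin n → ℝ)}

/-- A direction along which `B` recedes lies in the orthant, and the ray in this direction from
any point of the orthant reaches `B`. -/
theorem exists_add_smul_mem (hB : Admissible B) (hne : B.Nonempty) {δ u : Fin n → ℝ}
    (hδ : δ ∈ orthant n) (hu : ∀ b ∈ B, ∀ t : ℝ, 0 ≤ t → b + t • u ∈ B) (hu0 : u ≠ 0) :
    ∃ t : ℝ, 1 ≤ t ∧ δ + t • u ∈ B := by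
  obtain ⟨b, hb⟩ := hne
  have huC : u ∈ orthant n := by
    intro j
    obtain ⟨c, hc⟩ : LinearMap.proj j ∈ supportCone B := by
      rw [hB.supportCone_eq]; exact proj_mem_supportCone_orthant j
    by_contra! hneg
    have hcb : c ≤ b j := hc ⟨b, hb, rfl⟩
    have h1 := hc ⟨_, hu b hb ((c - b j - 1) / u j)
      (div_nonneg_of_nonpos (by linarith) hneg.le), rfl⟩
    simp [div_mul_cancel₀ _ hneg.ne] at h1
    linarith
  obtain ⟨R, hR⟩ := hB.exists_sum_lt
  have hpos : 0 < ∑ j, u j := by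
    refine (sum_nonneg_of_mem_orthant huC).lt_of_ne fun h0 => hu0 ?_
    funext j
    exact (Finset.sum_eq_zero_iff_of_nonneg fun i _ => huC i).1 h0.symm j (Finset.mem_univ j)
  have ht0 : 0 ≤ R / ∑ j, u j := by positivity
  refine ⟨1 + R / ∑ j, u j, by linarith, ?_⟩
  by_contra hnot
  have h1 := hR _ (add_mem_orthant hδ (smul_mem_orthant (by linarith) huC)) hnot
  have h2 : ∑ j, (δ + (1 + R / ∑ j, u j) • u) j =
      ∑ j, δ j + (∑ j, u j + R) := by
    simp only [Pi.add_apply, Pi.smul_apply, smul_eq_mul, Finset.sum_add_distrib, ← Finset.mul_sum]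
    rw [add_mul, one_mul, div_mul_cancel₀ _ hpos.ne']
  rw [h2] at h1
  linarith [sum_nonneg_of_mem_orthant hδ]

theorem isPolyhedron_convexHull_union_singleton [NeZero n] (hB : Admissible B) {δ : Fin n → ℝ}
    (hδ : δ ∈ orthant n) : IsPolyhedron (convexHull ℝ (B ∪ {δ})) := by
  have hne := hB.nonempty
  have hconvB := hB.isPolyhedron.convex
  obtain ⟨s, hs, -, hBs⟩ := hB.isPolyhedron
  -- `t` is the coefficient of the point of `B` in a convex combination with `δ`
  set s₁ : Set (ℝ × ℝ × Module.Dual ℝ (Fin n → ℝ)) :=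
    (fun h => (h.2 - h.1 δ, h.1 δ, h.1)) '' s ∪ {(1, -1, 0), (-1, 0, 0)} with hs₁
  obtain ⟨s', hs', he⟩ := exists_finite_eliminate s₁
    ((hs.image _).union (Set.toFinite {(1, -1, 0), (-1, 0, 0)}))
  have hmem : ∀ x (t : ℝ), (∀ h ∈ s₁, t * h.1 + h.2.1 ≤ h.2.2 x) ↔
      (0 ≤ t ∧ t ≤ 1 ∧ ∀ h ∈ s, t * (h.2 - h.1 δ) + h.1 δ ≤ h.1 x) := by
    intro x t
    constructor
    · intro h
      have h1 := h (1, -1, 0) (Or.inr (by simp))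
      have h2 := h (-1, 0, 0) (Or.inr (by simp))
      simp at h1 h2
      exact ⟨h2, by linarith, fun g hg => h _ (Or.inl ⟨g, hg, rfl⟩)⟩
    · rintro ⟨h0, h1, h⟩ _ (⟨g, hg, rfl⟩ | rfl | rfl)
      · exact h g hg
      · simp; linarith
      · simp; linarith
  have heq : convexHull ℝ (B ∪ {δ}) =
      {x | ∃ t : ℝ, ∀ h ∈ s₁, t * h.1 + h.2.1 ≤ h.2.2 x} := by
    refine Set.Subset.antisymm (convexHull_min ?_ ?_) ?_
    · rintro x (hx | rfl)
      · refine ⟨1, (hmem x 1).2 ⟨zero_le_one, le_rfl, fun h hh => ?_⟩⟩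
        rw [hBs] at hx
        linarith [hx h hh]
      · exact ⟨0, (hmem _ 0).2 ⟨le_rfl, zero_le_one, fun h hh => by linarith⟩⟩
    · rintro x ⟨t, ht⟩ y ⟨r, hr⟩ α β hα hβ hαβ
      refine ⟨α * t + β * r, fun h hh => ?_⟩
      have h1 := mul_le_mul_of_nonneg_left (ht h hh) hα
      have h2 := mul_le_mul_of_nonneg_left (hr h hh) hβ
      have h3 : h.2.1 = α * h.2.1 + β * h.2.1 := by rw [← add_mul, hαβ, one_mul]
      rw [map_add, map_smul, map_smul, smul_eq_mul, smul_eq_mul]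
      linarith
    · rintro x ⟨t, ht⟩
      obtain ⟨h0, h1, h⟩ := (hmem x t).1 ht
      have hδ' : δ ∈ convexHull ℝ (B ∪ {δ}) := subset_convexHull ℝ _ (Or.inr rfl)
      have hBsub : B ⊆ convexHull ℝ (B ∪ {δ}) := fun b hb => subset_convexHull ℝ _ (Or.inl hb)
      -- in both cases `x` lies between `δ` and a point `δ + T • (x - δ)` of `B`
      have hT : x = δ ∨ ∃ T : ℝ, 1 ≤ T ∧ δ + T • (x - δ) ∈ B := by
        rcases h0.eq_or_lt with rfl | hpos
        · by_cases hx : x = δ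
          · exact Or.inl hx
          · refine Or.inr (hB.exists_add_smul_mem hne hδ (fun b hb r hr => ?_) (sub_ne_zero.2 hx))
            rw [hBs] at hb ⊢
            intro g hg
            have h2 := hb g hg
            have h3 := mul_nonneg hr (by linarith [h g hg] : 0 ≤ g.1 x - g.1 δ)
            rw [map_add, map_smul, map_sub, smul_eq_mul]
            linarith
        · refine Or.inr ⟨1 / t, (one_le_div hpos).2 h1, ?_⟩
          rw [hBs]
          intro g hg
          rw [map_add, map_smul, map_sub, smul_eq_mul, div_mul_eq_mul_div, one_mul]
          have : g.2 - g.1 δ ≤ (g.1 x - g.1 δ) / t := by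
            rw [le_div_iff₀ hpos]
            linarith [h g hg]
          linarith
      rcases hT with rfl | ⟨T, hT1, hT⟩
      · exact hδ'
      · have hT0 : 0 < T := by linarith
        have := (convex_convexHull ℝ (B ∪ {δ})).add_smul_mem hδ' (hBsub hT) (t := 1 / T)
          ⟨by positivity, (div_le_one hT0).2 hT1⟩
        rwa [smul_smul, one_div_mul_cancel hT0.ne', one_smul, add_sub_cancel] at this
  rw [heq, he]
  refine isPolyhedron_of_finite hs' ?_
  rw [← he, ← heq]
  exact ⟨δ, subset_convexHull ℝ _ (Or.inr rfl)⟩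

theorem convexHull_union_singleton [NeZero n] (hB : Admissible B) (hBC : B ⊆ orthant n)
    {δ : Fin n → ℝ} (hδ : δ ∈ orthant n) (hl : δ ∈ latticePoints n) :
    Admissible (convexHull ℝ (B ∪ {δ})) := by
  have hpoly := hB.isPolyhedron_convexHull_union_singleton hδ
  have hBsub : B ⊆ convexHull ℝ (B ∪ {δ}) := fun b hb => subset_convexHull ℝ _ (Or.inl hb)
  have hsubC : convexHull ℝ (B ∪ {δ}) ⊆ orthant n :=
    convexHull_min (Set.union_subset hBC (Set.singleton_subset_iff.2 hδ)) convex_orthant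
  refine ⟨⟨hpoly, fun x hx => ?_⟩, hB.2.1, hpoly, rfl, ?_, ?_⟩
  · rcases extremePoints_convexHull_subset hx with hxB | rfl
    · exact hB.1.2 (inter_extremePoints_subset_extremePoints_of_subset hBsub ⟨hxB, hx⟩)
    · exact hl
  · rw [← hB.supportCone_eq]
    ext γ
    refine ⟨fun h => h.mono (Set.image_mono hBsub), ?_⟩
    rintro ⟨c, hc⟩
    refine ⟨min c (γ δ), ?_⟩
    rintro _ ⟨x, hx, rfl⟩
    have hconv : Convex ℝ {x | min c (γ δ) ≤ γ x} := convex_halfSpace_ge γ.isLinear _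
    refine convexHull_min ?_ hconv hx
    rintro y (hy | rfl)
    · exact (min_le_left c (γ δ)).trans (hc ⟨y, hy, rfl⟩)
    · exact min_le_right c _
  · refine hB.2.2.2.2.2.subset ?_
    rintro x (⟨h1, h2⟩ | ⟨h1, h2⟩)
    · exact Or.inl ⟨h1, fun h => h2 (hBsub h)⟩
    · exact absurd (hsubC h1) h2

end Admissible

end RelMixedVolume

/-! ### Monotonicity of the relative mixed volume and minimal tuples -/

namespace RelMixedVolume

variable {n : ℕ}

theorem sum_orthant {κ : Type*} {I : Finset κ} (hI : I.Nonempty) :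
    ∑ _i ∈ I, orthant n = orthant n := by
  classical
  induction hI using Finset.Nonempty.cons_induction with
  | singleton i => simp
  | cons i I hi _ ih => rw [Finset.sum_cons, ih, orthant_add_orthant]

theorem pairVolume_sum_empty {B : Fin n → Set (Fin n → ℝ)} :
    pairVolume (∑ i ∈ (∅ : Finset (Fin n)), (orthant n, B i)) = 0 := by
  simp [pairVolume]

theorem pairVolume_of_subset {A B : Set (Fin n → ℝ)} (h : B ⊆ A) :
    pairVolume (A, B) = (n ! : ℝ) * volume.real (A \ B) := by
  simp [pairVolume, Set.sdiff_eq_empty.2 h]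

/-- A simultaneous truncation turns the relative mixed volume into the difference of a constant
and a mixed volume of lattice polytopes. -/
theorem relMixedVolume_eq [NeZero n] {B : Fin n → Set (Fin n → ℝ)} (hB : ∀ i, Admissible (B i))
    (hBC : ∀ i, B i ⊆ orthant n) {R : ℕ} (hR0 : 0 < R)
    (hR : ∀ i, ∀ x ∈ orthant n, x ∉ B i → ∑ j, x j < R) :
    relMixedVolume B =
      ∑ I : Finset (Fin n), (-1 : ℝ) ^ (n - I.card) * volume.real (simplex n (I.card * R)) -
      ∑ I : Finset (Fin n), (-1 : ℝ) ^ (n - I.card) *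
        volume.real (∑ i ∈ I, convexHull ℝ (cubePoint n R '' truncation R (B i))) := by
  set K : Fin n → Set (Fin n → ℝ) := fun i => convexHull ℝ (cubePoint n R '' truncation R (B i))
    with hK
  have hKB : ∀ i, B i ∩ simplex n R = K i := fun i =>
    (hB i).inter_simplex_eq_convexHull (hBC i) (hR i) hR0
  have hR0' : (0 : ℝ) < R := Nat.cast_pos.2 hR0
  have hterm : ∀ I : Finset (Fin n), pairVolume (∑ i ∈ I, (orthant n, B i)) =
      (n ! : ℝ) * (volume.real (simplex n (I.card * R)) - volume.real (∑ i ∈ I, K i)) := by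
    intro I
    rcases I.eq_empty_or_nonempty with rfl | hI
    -- the empty sum is the point `0`, which is also the simplex of size `0`
    · rw [pairVolume_sum_empty]
      have h1 : simplex n ((Finset.card (∅ : Finset (Fin n)) : ℕ) * (R : ℝ)) =
          ∑ i ∈ (∅ : Finset (Fin n)), K i := by
        rw [Finset.sum_empty]
        ext x
        simp only [Finset.card_empty, Nat.cast_zero, zero_mul, Set.mem_zero]
        constructor
        · rintro ⟨hx, hx'⟩
          funext j
          exact (Finset.sum_eq_zero_iff_of_nonneg fun i _ => hx i).1
            (le_antisymm hx' (sum_nonneg_of_mem_orthant hx)) j (Finset.mem_univ j)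
        · rintro rfl
          exact ⟨zero_mem_orthant, by simp⟩
      rw [h1, sub_self, mul_zero]
    · set s : ℝ := I.card * R with hs
      have hs0 : 0 < s := mul_pos (Nat.cast_pos.2 hI.card_pos) hR0'
      have hconv : Convex ℝ (∑ i ∈ I, K i) := convex_sum _ fun i _ => convex_convexHull ℝ _
      have hcomp : IsCompact (∑ i ∈ I, K i) := isCompact_finset_sum I fun i _ =>
        (Set.toFinite _).isCompact_convexHull (𝕜 := ℝ)
      have hsub : ∑ i ∈ I, K i ⊆ simplex n s := by
        intro x hx
        obtain ⟨g, hg, rfl⟩ := (Set.mem_finsetSum I _ x).1 hx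
        have hg' : ∀ i ∈ I, g i ∈ simplex n R := fun i hi => by
          have h := hg hi
          rw [← hKB i] at h
          exact h.2
        refine ⟨fun j => ?_, ?_⟩
        · rw [Finset.sum_apply]
          exact Finset.sum_nonneg fun i hi => (hg' i hi).1 j
        · simp_rw [Finset.sum_apply]
          rw [Finset.sum_comm]
          refine (Finset.sum_le_sum fun i hi => (hg' i hi).2).trans ?_
          rw [Finset.sum_const, nsmul_eq_mul]
      have hvert : ∀ j, Pi.single j s ∈ ∑ i ∈ I, K i := by
        intro j
        have e : (Pi.single j s : Fin n → ℝ) = ∑ _i ∈ I, Pi.single j (R : ℝ) := by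
          rw [Finset.sum_const, ← Pi.single_smul, nsmul_eq_mul]
        rw [e]
        refine Set.finsetSum_mem_finsetSum I _ _ fun i _ => ?_
        rw [← hKB i]
        exact ⟨Admissible.single_mem (hR i) j le_rfl, single_mem_orthant j hR0'.le, by simp⟩
      have e1 : ∑ i ∈ I, (orthant n, B i) = (orthant n, ∑ i ∈ I, K i + orthant n) := by
        refine Prod.ext ?_ ?_
        · rw [Prod.fst_sum]
          exact sum_orthant hI
        · rw [Prod.snd_sum]
          have : ∀ i, B i = K i + orthant n := fun i =>
            (hB i).eq_convexHull_add_orthant (hBC i) (hR i) hR0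
          calc ∑ i ∈ I, B i = ∑ i ∈ I, (K i + orthant n) := Finset.sum_congr rfl fun i _ => this i
            _ = ∑ i ∈ I, K i + orthant n := by rw [Finset.sum_add_distrib, sum_orthant hI]
      rw [e1, pairVolume_of_subset, orthant_diff_add_orthant hs0 hconv hsub hvert,
        measureReal_sdiff hsub hcomp.measurableSet (isCompact_simplex s).measure_lt_top.ne]
      exact Set.add_subset_iff.2 fun x hx c hc => add_mem_orthant (hsub hx).1 hc
  have hfac : (n ! : ℝ) ≠ 0 := by positivity
  rw [relMixedVolume, mixedVolume, ← Finset.sum_sub_distrib, Finset.mul_sum]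
  refine Finset.sum_congr rfl fun I _ => ?_
  rw [hterm I]
  field_simp

/-- Enlarging the polyhedra can only decrease the relative mixed volume. -/
theorem relMixedVolume_anti [NeZero n] {B B' : Fin n → Set (Fin n → ℝ)}
    (hB : ∀ i, Admissible (B i)) (hB' : ∀ i, Admissible (B' i)) (hBC' : ∀ i, B' i ⊆ orthant n)
    (h : ∀ i, B i ⊆ B' i) : relMixedVolume B' ≤ relMixedVolume B := by
  choose r hr using fun i => (hB i).exists_sum_lt
  -- with `R ≥ r i + 2`, both `R • e j` and `(R - 1) • e j` survive the truncation
  set R : ℕ := ∑ i, r i + 2 with hRdef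
  have hrR : ∀ i, (r i : ℝ) ≤ (R - 1 : ℕ) := fun i => by
    have := Finset.single_le_sum (f := r) (fun i _ => Nat.zero_le _) (Finset.mem_univ i)
    exact_mod_cast (by omega : r i ≤ R - 1)
  have hlt : ((R - 1 : ℕ) : ℝ) < R := by exact_mod_cast (by omega : R - 1 < R)
  have hR : ∀ i, ∀ x ∈ orthant n, x ∉ B i → ∑ j, x j < R := fun i x hx hxB =>
    (hr i x hx hxB).trans_le ((hrR i).trans hlt.le)
  have hR' : ∀ i, ∀ x ∈ orthant n, x ∉ B' i → ∑ j, x j < R := fun i x hx hxB =>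
    hR i x hx fun hx' => hxB (h i hx')
  have hR0 : 0 < R := by omega
  rw [relMixedVolume_eq hB (fun i => (h i).trans (hBC' i)) hR0 hR,
    relMixedVolume_eq hB' hBC' hR0 hR']
  refine sub_le_sub_left (alternating_volume_convexHull_mono
    (S := fun i => truncation R (B i)) (T := fun i => truncation R (B' i))
    (fun i k hk => ⟨h i hk.1, hk.2⟩) fun i v hv => ?_) _
  obtain ⟨j, hj⟩ := Function.ne_iff.1 hv
  have hmem : ∀ m : ℕ, r i ≤ m → m ≤ R → Pi.single j (m : ℝ) ∈
      cubePoint n R '' truncation R (B i) := by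
    intro m hm hmR
    rw [image_cubePoint_truncation]
    exact ⟨⟨Admissible.single_mem (hr i) j (Nat.cast_le.2 hm),
      single_mem_orthant j (Nat.cast_nonneg m), by simpa using hmR⟩, single_mem_latticePoints j m⟩
  have hm1 : r i ≤ R - 1 := by exact_mod_cast hrR i
  obtain ⟨k, hk, hk'⟩ := hmem R (by omega) le_rfl
  obtain ⟨l, hl, hl'⟩ := hmem (R - 1) hm1 (by omega)
  refine ⟨k, hk, l, hl, ?_⟩
  rw [hk', hl', single_dotProduct, single_dotProduct]
  exact fun e => hlt.ne' (mul_right_cancel₀ hj e)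

theorem admissible_update [NeZero n] {B : Fin n → Set (Fin n → ℝ)} (hB : ∀ i, Admissible (B i))
    {i : Fin n} (hBC : B i ⊆ orthant n) {δ : Fin n → ℝ} (hδ : δ ∈ orthant n)
    (hl : δ ∈ latticePoints n) (k : Fin n) :
    Admissible (Function.update B i (convexHull ℝ (B i ∪ {δ})) k) := by
  rcases eq_or_ne k i with rfl | hk
  · rw [Function.update_self]
    exact (hB k).convexHull_union_singleton hBC hδ hl
  · rw [Function.update_of_ne hk]
    exact hB k

/-- A minimal tuple is not properly contained in another tuple of the same relative mixed
volume. -/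
theorem IsMinimalTuple.eq_of_subset [NeZero n] {V : ℝ} {M N : Fin n → Set (Fin n → ℝ)}
    (hM : IsMinimalTuple V M) (hN : ∀ i, Admissible (N i)) (hNV : relMixedVolume N = V)
    (hNC : ∀ i, N i ⊆ orthant n) (h : ∀ i, M i ⊆ N i) : M = N := by
  funext i
  refine Set.Subset.antisymm (h i) ?_
  refine (hN i).subset_of_latticePoints_subset (hNC i) (hM.1 i) fun δ hδ => ?_
  by_contra hδM
  have hMC := (h i).trans (hNC i)
  have h1 := hM.2.2 i δ ⟨hNC i hδ.1, hδM⟩ hδ.2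
  have h2 : relMixedVolume N ≤ _ := relMixedVolume_anti
    (admissible_update hM.1 hMC (hNC i hδ.1) hδ.2) hN hNC fun k => by
      rcases eq_or_ne k i with rfl | hk
      · rw [Function.update_self]
        exact convexHull_min (Set.union_subset (h k) (Set.singleton_subset_iff.2 hδ.1))
          (hN k).isPolyhedron.convex
      · rw [Function.update_of_ne hk]
        exact h k
  linarith

/-- The upper set of all points of `ℕⁿ` in `B`, that is, the exponents of the monomials in the
monomial ideal of `B`. -/
def exponents {B : Set (Fin n → ℝ)} (hB : Admissible B) : UpperSet (Fin n → ℕ) where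
  carrier := {k | (fun j => (k j : ℝ)) ∈ B}
  upper' k l hkl hk := by
    have h := hB.add_mem hk (c := fun j => (l j : ℝ) - k j) fun j =>
      sub_nonneg.2 (Nat.cast_le.2 (hkl j))
    have e : (fun j => (k j : ℝ)) + (fun j => (l j : ℝ) - k j) = fun j => (l j : ℝ) := by
      funext j
      simp
    rwa [e] at h

theorem subset_of_exponents_le [NeZero n] {B B' : Set (Fin n → ℝ)} (hB : Admissible B)
    (hBC : B ⊆ orthant n) (hB' : Admissible B') (h : exponents hB' ≤ exponents hB) : B ⊆ B' := by
  refine hB.subset_of_latticePoints_subset hBC hB' fun x hx => ?_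
  choose m hm using hx.2
  have e : x = fun j => (((m j).toNat : ℕ) : ℝ) := by
    funext j
    have h0 : 0 ≤ m j := by
      have := hBC hx.1 j
      rw [hm] at this
      exact_mod_cast this
    rw [hm]
    exact_mod_cast (Int.toNat_of_nonneg h0).symm
  have h1 : (fun j => (m j).toNat) ∈ exponents hB := by
    change (fun j => (((m j).toNat : ℕ) : ℝ)) ∈ B
    rw [← e]
    exact hx.1
  have h2 : (fun j => (((m j).toNat : ℕ) : ℝ)) ∈ B' := h h1
  rwa [← e] at h2

/-- Minimal tuples form an antichain in a well-quasi-order. -/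
theorem finite_isMinimalTuple (hn : 2 ≤ n) (V : ℝ) :
    {B : Fin n → Set (Fin n → ℝ) | IsMinimalTuple V B}.Finite := by
  have : NeZero n := ⟨by omega⟩
  have := wellQuasiOrderedLE_upperSet_fin n
  rw [← Set.finite_coe_iff, ← Set.finite_univ_iff]
  let E : {B : Fin n → Set (Fin n → ℝ) | IsMinimalTuple V B} → Fin n → UpperSet (Fin n → ℕ) :=
    fun B i => exponents (B.2.1 i)
  refine IsAntichain.finite_of_wellQuasiOrdered (r := fun B B' => E B ≤ E B') ?_
    fun f => wellQuasiOrdered_le (fun m => E (f m))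
  intro B _ B' _ hne hle
  have hC : ∀ i, B.1 i ⊆ orthant n := fun i => Admissible.subset_orthant hn (B.2.1 i)
  have hC' : ∀ i, B'.1 i ⊆ orthant n := fun i => Admissible.subset_orthant hn (B'.2.1 i)
  exact hne (Subtype.ext (B'.2.eq_of_subset B.2.1 B.2.2.1 hC
    fun i => subset_of_exponents_le (B'.2.1 i) (hC' i) (B.2.1 i) (hle i)).symm)

theorem finite_latticePoints_diff {B : Set (Fin n → ℝ)} (hB : Admissible B) :
    ((orthant n \ B) ∩ latticePoints n).Finite := by
  obtain ⟨R, hR⟩ := hB.exists_sum_lt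
  have h : (orthant n \ B) ∩ latticePoints n ⊆ cubePoint n R '' truncation R (orthant n) := by
    rw [image_cubePoint_truncation]
    exact fun x hx => ⟨⟨hx.1.1, hx.1.1, (hR x hx.1.1 hx.1.2).le⟩, hx.2⟩
  exact (Set.toFinite _).subset h

/-- Lattice points are adjoined as long as this does not change the relative mixed volume; only
finitely many are available. -/
theorem exists_isMinimalTuple [NeZero n] (V : ℝ) (B : Fin n → Set (Fin n → ℝ))
    (hB : ∀ i, Admissible (B i)) (hBC : ∀ i, B i ⊆ orthant n) (hV : relMixedVolume B = V) :
    ∃ M, IsMinimalTuple V M ∧ ∀ i, B i ⊆ M i := by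
  induction hN : ∑ i, ((orthant n \ B i) ∩ latticePoints n).ncard using Nat.strong_induction_on
    generalizing B with
  | _ N ih =>
    by_cases hmin : IsMinimalTuple V B
    · exact ⟨B, hmin, fun i => subset_rfl⟩
    obtain ⟨i, δ, hδ, hl, hge⟩ : ∃ i, ∃ δ ∈ orthant n \ B i, δ ∈ latticePoints n ∧
        V ≤ relMixedVolume (Function.update B i (convexHull ℝ (B i ∪ {δ}))) := by
      by_contra! hcon
      exact hmin ⟨hB, hV, hcon⟩
    set B' := Function.update B i (convexHull ℝ (B i ∪ {δ})) with hB'def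
    have hi : B' i = convexHull ℝ (B i ∪ {δ}) := Function.update_self ..
    have hk : ∀ k, k ≠ i → B' k = B k := fun k hk => Function.update_of_ne hk ..
    have hB' : ∀ k, Admissible (B' k) := admissible_update hB (hBC i) hδ.1 hl
    have hsub : ∀ k, B k ⊆ B' k := fun k => by
      rcases eq_or_ne k i with rfl | hki
      · rw [hi]
        exact fun b hb => subset_convexHull ℝ _ (Or.inl hb)
      · rw [hk k hki]
    have hBC' : ∀ k, B' k ⊆ orthant n := fun k => by
      rcases eq_or_ne k i with rfl | hki
      · rw [hi]
        exact convexHull_min (Set.union_subset (hBC k) (Set.singleton_subset_iff.2 hδ.1))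
          convex_orthant
      · rw [hk k hki]
        exact hBC k
    have hV' : relMixedVolume B' = V :=
      le_antisymm (hV ▸ relMixedVolume_anti hB hB' hBC' hsub) hge
    have hmono : ∀ k, (orthant n \ B' k) ∩ latticePoints n ⊆ (orthant n \ B k) ∩ latticePoints n :=
      fun k x hx => ⟨⟨hx.1.1, fun h => hx.1.2 (hsub k h)⟩, hx.2⟩
    have hcard : ∑ k, ((orthant n \ B' k) ∩ latticePoints n).ncard < N := by
      rw [← hN]
      refine Finset.sum_lt_sum (fun k _ => Set.ncard_le_ncard (hmono k)
        (finite_latticePoints_diff (hB k))) ⟨i, Finset.mem_univ i, Set.ncard_lt_ncard ?_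
        (finite_latticePoints_diff (hB i))⟩
      refine (Set.ssubset_iff_of_subset (hmono i)).2 ⟨δ, ⟨hδ, hl⟩, fun h => h.1.2 ?_⟩
      rw [hi]
      exact subset_convexHull ℝ _ (Or.inr rfl)
    obtain ⟨M, hM, hM'⟩ := ih _ hcard B' hB' hBC' hV' rfl
    exact ⟨M, hM, fun k => (hsub k).trans (hM' k)⟩

theorem Admissible.eq_halfLine {B : Set (Fin 1 → ℝ)} (hB : Admissible B) :
    ∃ b : ℝ, B = {x | b ≤ x 0} := by
  set T : Set ℝ := {t | (fun _ => t) ∈ B} with hT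
  have hmem : ∀ x : Fin 1 → ℝ, x ∈ B ↔ x 0 ∈ T := fun x => by
    have : x = fun _ => x 0 := by funext j; rw [Subsingleton.elim j 0]
    simp only [hT, Set.mem_ofPred_eq]
    rw [← this]
  have hne : T.Nonempty := by
    obtain ⟨x, hx⟩ := hB.nonempty
    exact ⟨x 0, (hmem x).1 hx⟩
  have hbdd : BddBelow T := by
    obtain ⟨c, hc⟩ : LinearMap.proj (0 : Fin 1) ∈ supportCone B := by
      rw [hB.supportCone_eq]; exact proj_mem_supportCone_orthant 0
    exact ⟨c, fun t ht => hc ⟨_, ht, rfl⟩⟩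
  have hclosed : IsClosed T := hB.isPolyhedron.isClosed.preimage (by fun_prop)
  refine ⟨sInf T, Set.ext fun x => ?_⟩
  rw [hmem]
  refine ⟨fun h => csInf_le hbdd h, fun h => ?_⟩
  have h1 := hB.add_mem (hclosed.csInf_mem hne hbdd) (c := fun _ => x 0 - sInf T)
    fun _ => sub_nonneg.2 h
  have e : ((fun _ => sInf T) + (fun _ => x 0 - sInf T) : Fin 1 → ℝ) = fun _ => x 0 := by
    funext j
    simp
  rw [e] at h1
  exact h1

theorem relMixedVolume_halfLine {B : Fin 1 → Set (Fin 1 → ℝ)} {b : ℝ}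
    (h : B 0 = {x | b ≤ x 0}) : relMixedVolume B = b := by
  have e1 : orthant 1 \ B 0 = Set.pi Set.univ fun _ => Set.Ico 0 b := by
    ext x
    simp [h, orthant, Set.mem_pi]
  have e2 : B 0 \ orthant 1 = Set.pi Set.univ fun _ => Set.Ico b 0 := by
    ext x
    simp [h, orthant, Set.mem_pi]
  have hu : (Finset.univ : Finset (Finset (Fin 1))) = {∅, {0}} := by decide
  rw [relMixedVolume, mixedVolume, hu, Finset.sum_pair (by decide), pairVolume_sum_empty]
  simp only [Finset.sum_singleton, pairVolume, e1, e2, Measure.real, Real.volume_pi_Ico]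
  rcases le_total 0 b with hb | hb
  · simp [ENNReal.toReal_ofReal', hb]
  · simp [ENNReal.toReal_ofReal', hb]

theorem isMinimalTuple_of_dimension_one {B : Fin 1 → Set (Fin 1 → ℝ)}
    (hB : ∀ i, Admissible (B i)) : IsMinimalTuple (relMixedVolume B) B := by
  refine ⟨hB, rfl, fun i δ hδ hl => ?_⟩
  obtain rfl : i = 0 := Subsingleton.elim _ _
  obtain ⟨b, hb⟩ := (hB 0).eq_halfLine
  have hδb : δ 0 < b := by
    have := hδ.2
    rw [hb] at this
    simpa using this
  have hBC : B 0 ⊆ orthant 1 := by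
    rw [hb]
    intro x hx j
    rw [Subsingleton.elim j 0]
    exact ((hδ.1 0).trans hδb.le).trans hx
  obtain ⟨b', hb'⟩ := ((hB 0).convexHull_union_singleton hBC hδ.1 hl).eq_halfLine
  have hmem : δ ∈ convexHull ℝ (B 0 ∪ {δ}) := subset_convexHull ℝ _ (Or.inr rfl)
  rw [hb'] at hmem
  rw [relMixedVolume_halfLine hb,
    relMixedVolume_halfLine (b := b') (by rw [Function.update_self, hb'])]
  exact lt_of_le_of_lt hmem hδb

end RelMixedVolume

theorem mainTheorem4 (n : ℕ) (V : ℝ) :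
    {B : Fin n → Set (Fin n → ℝ) | RelMixedVolume.IsMinimalTuple V B}.Finite ∧
    ∀ B : Fin n → Set (Fin n → ℝ),
      RelMixedVolume.IsLatticeTuple B → RelMixedVolume.relMixedVolume B = V →
        ∃ M : Fin n → Set (Fin n → ℝ),
          RelMixedVolume.IsMinimalTuple V M ∧ ∀ i, B i ⊆ M i := by
  rcases (by omega : n = 0 ∨ n = 1 ∨ 2 ≤ n) with rfl | rfl | hn
  · exact ⟨Set.toFinite _, fun B hB hV => ⟨B, ⟨hB, hV, fun i => i.elim0⟩, fun i => i.elim0⟩⟩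
  · refine ⟨(Set.finite_singleton fun _ : Fin 1 => {x : Fin 1 → ℝ | V ≤ x 0}).subset
      fun B hB => ?_, fun B hB hV =>
        ⟨B, hV ▸ RelMixedVolume.isMinimalTuple_of_dimension_one hB, fun i => subset_rfl⟩⟩
    obtain ⟨b, hb⟩ := RelMixedVolume.Admissible.eq_halfLine (hB.1 0)
    have hbV : b = V := (RelMixedVolume.relMixedVolume_halfLine hb).symm.trans hB.2.1
    rw [Set.mem_singleton_iff]
    funext i
    rw [Subsingleton.elim i 0, hb, hbV]
  · have : NeZero n := ⟨by omega⟩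
    exact ⟨RelMixedVolume.finite_isMinimalTuple hn V, fun B hB hV =>
      RelMixedVolume.exists_isMinimalTuple V B hB
        (fun i => RelMixedVolume.Admissible.subset_orthant hn (hB i)) hV⟩
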